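/- Let $n\ge 2$ and $m\ge 0$ be integers, $s\in\mathbb R$ and $T>0$. For $r\in\mathbb R$ let $H^r(\mathbb R^n)$ be the space of tempered distributions $f$ on $\mathbb R^n$ with $\|f\|_{H^r}=\|(1+|\xi|^2)^{r/2}\hat f\|_{L^2(\mathbb R^n)}<\infty$. Then there is a constant $C>0$ (depending only on $n,m,s,T$) such that for all $\phi_1\in H^{s}(\mathbb R^n)$ and $\phi_2\in H^{s-\frac{2}{m+2}}(\mathbb R^n)$ the Cauchy problem $$\partial_t^2u-t^m\Delta u=0\quad\text{in }[0,\infty)\times\mathbb R^n,\qquad u(0,\cdot)=\phi_1,\quad \partial_tu(0,\cdot)=\phi_2$$ (where $u(t,\cdot)$ is a tempered distribution for each $t$, and the $t$-derivatives are taken in the space of tempered distributions, one-sided at $t=0$) has a solution $$u\in C([0,T],H^s(\mathbb R^n))\cap C((0,T],H^{s+\frac{m}{2(m+2)}}(\mathbb R^n))\cap C^1([0,T],H^{s-\frac{m+4}{2(m+2)}}(\mathbb R^n))$$ which satisfies, for all $0<t\le T$, $$\|u(t,\cdot)\|_{H^s}+t^{\frac m4}\|u(t,\cdot)\|_{H^{s+\frac{m}{2(m+2)}}}+\|\partial_tu(t,\cdot)\|_{H^{s-\frac{m+4}{2(m+2)}}}\le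 C\big(\|\phi_1\|_{H^s}+\|\phi_2\|_{H^{s-\frac{2}{m+2}}}\big).$$ -/

import Mathlib

open MeasureTheory Set
open scoped SchwartzMap Laplacian

noncomputable section

/-- The (complex) vector space of all tempered distributions on `ℝⁿ` of Sobolev order `s`, i.e. all
`f` such that `(1 + |ξ|²)^(s/2) f̂` is square integrable. -/
def sobolevSubmodule (n : ℕ) (s : ℝ) : Submodule ℂ 𝓢'(EuclideanSpace ℝ (Fin n), ℂ) where
  carrier := {f | TemperedDistribution.MemSobolev s 2 f}
  add_mem' hf hg := hf.add hg
  zero_mem' := TemperedDistribution.memSobolev_fun_zero _ _ s 2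
  smul_mem' c _ hf := hf.smul c

/-- The Sobolev space `H^s(ℝⁿ)`. It is a type of its own because it carries the topology of the
Sobolev norm (defined below), not the one induced by the tempered distributions. -/
def SobolevSpace (n : ℕ) (s : ℝ) : Type := sobolevSubmodule n s

namespace SobolevSpace

variable {n : ℕ} {s : ℝ}

instance : AddCommGroup (SobolevSpace n s) :=
  inferInstanceAs (AddCommGroup (sobolevSubmodule n s))

instance : Module ℂ (SobolevSpace n s) :=
  inferInstanceAs (Module ℂ (sobolevSubmodule n s))

/-- The inclusion of `H^s(ℝⁿ)` into the tempered distributions. -/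
def toDistribution : SobolevSpace n s →ₗ[ℂ] 𝓢'(EuclideanSpace ℝ (Fin n), ℂ) :=
  (sobolevSubmodule n s).subtype

theorem memSobolev (f : SobolevSpace n s) :
    TemperedDistribution.MemSobolev s 2 (toDistribution f) :=
  Subtype.property f

theorem coe_L2_injective {f g : Lp ℂ 2 (volume : Measure (EuclideanSpace ℝ (Fin n)))}
    (h : (f : 𝓢'(EuclideanSpace ℝ (Fin n), ℂ)) = g) : f = g :=
  LinearMap.ker_eq_bot.mp (Lp.ker_toTemperedDistributionCLM_eq_bot
    (F := ℂ) (p := 2) (μ := (volume : Measure (EuclideanSpace ℝ (Fin n))))) h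

/-- The function in `L²(ℝⁿ)` that represents the Bessel potential `(1 + |ξ|²)^(s/2) f̂` (brought back
by the inverse Fourier transform) of an element `f` of `H^s(ℝⁿ)`. -/
def toL2 : SobolevSpace n s →ₗ[ℂ] Lp ℂ 2 (volume : Measure (EuclideanSpace ℝ (Fin n))) where
  toFun f := (memSobolev f).choose
  map_add' f g := by
    apply coe_L2_injective
    rw [← (memSobolev (f + g)).choose_spec, ← Lp.toTemperedDistributionCLM_apply]
    simp only [map_add, Lp.toTemperedDistributionCLM_apply]
    rw [← (memSobolev f).choose_spec, ← (memSobolev g).choose_spec]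
  map_smul' c f := by
    apply coe_L2_injective
    rw [← (memSobolev (c • f)).choose_spec, ← Lp.toTemperedDistributionCLM_apply]
    simp only [map_smul, Lp.toTemperedDistributionCLM_apply, RingHom.id_apply]
    rw [← (memSobolev f).choose_spec]

theorem besselPotential_eq (f : SobolevSpace n s) :
    TemperedDistribution.besselPotential _ ℂ s (toDistribution f) = toL2 f :=
  (memSobolev f).choose_spec

theorem toL2_injective :
    Function.Injective
      (toL2 : SobolevSpace n s → Lp ℂ 2 (volume : Measure (EuclideanSpace ℝ (Fin n)))) := by
  intro f g h
  apply Subtype.ext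
  change toDistribution f = toDistribution g
  have hf := besselPotential_eq f
  rw [h, ← besselPotential_eq g] at hf
  simpa using congrArg (TemperedDistribution.besselPotential _ ℂ (-s)) hf

/-- The Sobolev norm `‖f‖_{H^s} = ‖(1 + |ξ|²)^(s/2) f̂‖_{L²}`, where
`f̂(ξ) = ∫ f(x) exp(-2πi x·ξ) dx`; with another normalization of the Fourier transform one gets
an equivalent norm. -/
instance : NormedAddCommGroup (SobolevSpace n s) :=
  NormedAddCommGroup.induced _ _ (toL2 (n := n) (s := s)) toL2_injective

instance : NormedSpace ℂ (SobolevSpace n s) :=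
  NormedSpace.induced ℂ _ _ (toL2 (n := n) (s := s))

theorem norm_eq (f : SobolevSpace n s) : ‖f‖ = ‖toL2 f‖ := rfl

end SobolevSpace

/-- `u` solves the Cauchy problem `∂ₜ²u - t^m Δu = 0` on `[0, ∞) × ℝⁿ`, `u(0) = φ₁`, `∂ₜu(0) = φ₂`:
here `u` is a curve of tempered distributions, and `v` and `t^m Δu` are its first and second
derivative in `t` (one-sided at `t = 0`), in the topology of the tempered distributions, that is,
after pairing with each Schwartz function. -/
def IsTricomiSolution {n : ℕ} (m : ℕ) (φ₁ φ₂ : 𝓢'(EuclideanSpace ℝ (Fin n), ℂ))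
    (u : ℝ → 𝓢'(EuclideanSpace ℝ (Fin n), ℂ)) : Prop :=
  ∃ v : ℝ → 𝓢'(EuclideanSpace ℝ (Fin n), ℂ),
    u 0 = φ₁ ∧ v 0 = φ₂ ∧
    ∀ ψ : 𝓢(EuclideanSpace ℝ (Fin n), ℂ), ∀ t : ℝ, 0 ≤ t →
      HasDerivWithinAt (fun τ => u τ ψ) (v t ψ) (Ici 0) t ∧
      HasDerivWithinAt (fun τ => v τ ψ) ((t : ℂ) ^ m * (Δ (u t)) ψ) (Ici 0) t

end

/-!
On the Fourier side the equation is the ordinary differential equation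
`∂ₜ²û + t ^ m μ ^ (m + 2) û = 0` with `μ = (2π|ξ|) ^ ν`, `ν = 2 / (m + 2)`, for each frequency `ξ`.
By scaling, its solutions with data `(1, 0)` and `(0, 1)` at `t = 0` are `w₁(μ t)` and
`w₂(μ t) / μ`, where `w₁`, `w₂` are the power series solutions `airySol m 0`, `airySol m 1` of
`w'' + z ^ m w = 0`. So `u` is the sum of the Fourier multipliers with these symbols, applied to
`φ₁` and `φ₂`.

Everything then rests on the sharp bounds `|w(z)| ≲ (1 + z) ^ (-m/4)` and
`|w'(z)| ≲ (1 + z) ^ (m/4)` of `exists_wkb_bound`, which follow from a corrected energy whose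
derivative is integrable at infinity (`exists_energy_le`). As `(1 + |ξ|²) ^ (ν/2)` is comparable to
`1 + μ`, each factor `(1 + μ t) ^ (-1)` of decay is worth `ν` derivatives at the price of
`t ^ (-1)`: the decay of `w₁`, `w₂` gives the gain of `ν m / 4 = m / (2 (m + 2))` derivatives
with the weight `t ^ (m/4)`, the growth of `w₁'`, `w₂'` the loss in the bound for `∂ₜu`, and the factor `1 / μ` the
shift by `ν` in the order of `φ₂`.

Elements of `H^r` are represented by their weighted Fourier transforms in `L²`
(`SobolevSpace.ofFourier`). Continuity and differentiability in `t`, in a Sobolev space or tested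
against a Schwartz function, are dominated convergence for multiplication operators on `L²`
(`continuousOn_lpMul`, `hasDerivWithinAt_lpMul`). The equation holds because in `H^(s - 2)` the
curve is differentiable twice.
-/

/-! ### Everywhere convergent power series -/

/-- Differentiation of `∑ a_k z ^ q_k` preserves absolute convergence on all of `ℝ`. -/
theorem summable_mul_exponent {a : ℕ → ℝ} {q : ℕ → ℕ}
    (h : ∀ R : ℝ, 1 ≤ R → Summable fun k => |a k| * R ^ q k) (R : ℝ) (hR : 1 ≤ R) :
    Summable fun k => |a k * q k| * R ^ (q k - 1) := by
  refine Summable.of_nonneg_of_le (fun k => by positivity) (fun k => ?_) (h (2 * R) (by linarith))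
  rw [abs_mul, mul_assoc, Nat.abs_cast, mul_pow]
  have h1 : (q k : ℝ) ≤ 2 ^ q k := by exact_mod_cast (Nat.lt_two_pow_self).le
  have h2 : R ^ (q k - 1) ≤ R ^ q k := pow_le_pow_right₀ hR (Nat.sub_le _ _)
  gcongr

theorem hasDerivAt_tsum_mul_pow {a : ℕ → ℝ} {q : ℕ → ℕ}
    (h : ∀ R : ℝ, 1 ≤ R → Summable fun k => |a k| * R ^ q k) (z : ℝ) :
    HasDerivAt (fun z => ∑' k, a k * z ^ q k) (∑' k, a k * q k * z ^ (q k - 1)) z := by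
  have hR : (1 : ℝ) ≤ |z| + 2 := by linarith [abs_nonneg z]
  have hz : z ∈ Metric.ball (0 : ℝ) (|z| + 2) := by simp
  have h1 : (1 : ℝ) ∈ Metric.ball (0 : ℝ) (|z| + 2) := by
    simp only [mem_ball_zero_iff, norm_one]; linarith [abs_nonneg z]
  refine hasDerivAt_tsum_of_isPreconnected (𝕜 := ℝ) (g := fun k z => a k * z ^ q k)
    (g' := fun k z => a k * q k * z ^ (q k - 1)) (summable_mul_exponent h _ hR) Metric.isOpen_ball
    (convex_ball (0 : ℝ) (|z| + 2)).isPreconnected (fun k y _ => ?_)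
    (fun k y hy => ?_) h1 ?_ hz
  · rw [mul_assoc]
    exact (hasDerivAt_pow (q k) y).const_mul (a k)
  · rw [norm_mul, norm_pow, Real.norm_eq_abs]
    have : ‖y‖ ≤ |z| + 2 := by simpa using (Metric.mem_ball.mp hy).le
    gcongr
  · refine Summable.of_norm ?_
    simpa using h 1 le_rfl

/-! ### The ordinary differential equation `w'' + z ^ m w = 0` -/

/-- Coefficients of the power series solutions `∑ c_k z ^ ((m + 2) k + j)`, `j = 0, 1`, of
`w'' + z ^ m w = 0`. -/
noncomputable def airyCoeff (m j : ℕ) : ℕ → ℝ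
  | 0 => 1
  | k + 1 => -airyCoeff m j k /
      ((((m + 2) * (k + 1) + j : ℕ) : ℝ) * (((m + 2) * (k + 1) + j - 1 : ℕ) : ℝ))

/-- For `j = 0, 1`, the solution of `w'' + z ^ m w = 0` whose Taylor series at `0` starts with
`z ^ j`. -/
noncomputable def airySol (m j : ℕ) (z : ℝ) : ℝ := ∑' k, airyCoeff m j k * z ^ ((m + 2) * k + j)

/-- The derivative of `airySol`, as a power series. -/
noncomputable def airySolDeriv (m j : ℕ) (z : ℝ) : ℝ :=
  ∑' k, airyCoeff m j k * ((m + 2) * k + j : ℕ) * z ^ ((m + 2) * k + j - 1)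

/-- Each step of the recursion divides by at least `k + 1`. -/
theorem abs_airyCoeff_le (m j k : ℕ) : |airyCoeff m j k| ≤ 1 / (k.factorial : ℝ) := by
  induction k with
  | zero => simp [airyCoeff]
  | succ k ih =>
    rw [airyCoeff, abs_div, abs_neg, Nat.factorial_succ]
    have h1 : ((k + 1 : ℕ) : ℝ) ≤
        (((m + 2) * (k + 1) + j : ℕ) : ℝ) * (((m + 2) * (k + 1) + j - 1 : ℕ) : ℝ) := by
      have h2 : k + 1 ≤ (m + 2) * (k + 1) + j := by nlinarith
      have h3 : 1 ≤ (m + 2) * (k + 1) + j - 1 := by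
        have : 2 ≤ (m + 2) * (k + 1) + j := by nlinarith
        omega
      exact_mod_cast le_mul_of_le_of_one_le h2 h3
    rw [abs_of_nonneg (a := (_ : ℝ) * _) (by positivity),
      div_le_iff₀ (lt_of_lt_of_le (by positivity) h1)]
    calc |airyCoeff m j k| ≤ 1 / (k.factorial : ℝ) := ih
      _ = 1 / (((k + 1) * k.factorial : ℕ) : ℝ) * ((k + 1 : ℕ) : ℝ) := by
        push_cast; field_simp
      _ ≤ _ := by gcongr

theorem summable_airyCoeff (m j : ℕ) (R : ℝ) (hR : 1 ≤ R) :
    Summable fun k => |airyCoeff m j k| * R ^ ((m + 2) * k + j) := by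
  refine Summable.of_nonneg_of_le (fun k => by positivity) (fun k => ?_)
    ((Real.summable_pow_div_factorial (R ^ (m + 2))).mul_right (R ^ j))
  rw [pow_add, pow_mul, ← mul_assoc]
  gcongr
  rw [div_eq_mul_one_div, mul_comm]
  gcongr
  exact abs_airyCoeff_le m j k

theorem hasDerivAt_airySol (m j : ℕ) (z : ℝ) :
    HasDerivAt (airySol m j) (airySolDeriv m j z) z :=
  hasDerivAt_tsum_mul_pow (summable_airyCoeff m j) z

theorem hasDerivAt_airySolDeriv (m : ℕ) {j : ℕ} (hj : j ≤ 1) (z : ℝ) :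
    HasDerivAt (airySolDeriv m j) (-z ^ m * airySol m j z) z := by
  have hs := summable_mul_exponent (summable_airyCoeff m j)
  refine (hasDerivAt_tsum_mul_pow hs z).congr_deriv (Eq.symm ?_)
  have hsum : Summable fun k : ℕ => airyCoeff m j k * ((m + 2) * k + j : ℕ) *
      ((m + 2) * k + j - 1 : ℕ) * z ^ ((m + 2) * k + j - 1 - 1) := by
    refine Summable.of_norm_bounded (summable_mul_exponent hs (|z| + 1) (by simp)) fun k => ?_
    rw [norm_mul, norm_pow, Real.norm_eq_abs, Real.norm_eq_abs]
    gcongr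
    simp
  rw [hsum.tsum_eq_zero_add, airySol, ← tsum_mul_left]
  have h0 : (((m + 2) * 0 + j : ℕ) : ℝ) * (((m + 2) * 0 + j - 1 : ℕ) : ℝ) = 0 := by
    interval_cases j <;> simp
  rw [mul_assoc (airyCoeff m j 0), h0, mul_zero, zero_mul, zero_add]
  refine tsum_congr fun k => ?_
  have h2 : 2 ≤ (m + 2) * (k + 1) + j := by nlinarith
  have hexp : (m + 2) * (k + 1) + j - 1 - 1 = m + ((m + 2) * k + j) := by
    have : (m + 2) * (k + 1) = (m + 2) * k + (m + 2) := by ring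
    omega
  have hne : (((m + 2) * (k + 1) + j : ℕ) : ℝ) ≠ 0 := Nat.cast_ne_zero.mpr (by omega)
  have hne' : (((m + 2) * (k + 1) + j - 1 : ℕ) : ℝ) ≠ 0 := Nat.cast_ne_zero.mpr (by omega)
  rw [hexp, airyCoeff, pow_add, mul_assoc (_ / _), div_mul_cancel₀ _ (mul_ne_zero hne hne')]
  ring

theorem airySol_zero_zero (m : ℕ) : airySol m 0 0 = 1 := by
  rw [airySol, tsum_eq_single 0]
  · simp [airyCoeff]
  · intro k hk
    simp [hk]

theorem airySol_one_zero (m : ℕ) : airySol m 1 0 = 0 := by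
  simp [airySol]

theorem airySolDeriv_zero_zero (m : ℕ) : airySolDeriv m 0 0 = 0 := by
  rw [airySolDeriv]
  convert tsum_zero with k
  rcases Nat.eq_zero_or_pos k with rfl | hk
  · simp
  · have : (m + 2) * k + 0 - 1 ≠ 0 := by
      have : 2 ≤ (m + 2) * k := by nlinarith
      omega
    rw [zero_pow this, mul_zero]

theorem airySolDeriv_one_zero (m : ℕ) : airySolDeriv m 1 0 = 1 := by
  rw [airySolDeriv, tsum_eq_single 0]
  · simp [airyCoeff]
  · intro k hk
    simp [hk]

/-! ### The WKB bounds for `w'' + z ^ m w = 0` -/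

/-- The energy `z ^ (-m/2) w' ^ 2 + z ^ (m/2) w ^ 2` of a solution of `w'' + z ^ m w = 0` is bounded
for large `z`. Adding the correction `(m/2) z ^ (-m/2 - 1) w w'` cancels the principal part of its
derivative, and what is left is integrable at infinity. -/
theorem exists_energy_le {m : ℕ} {w w' : ℝ → ℝ} (hw : ∀ z, HasDerivAt w (w' z) z)
    (hw' : ∀ z, HasDerivAt w' (-z ^ m * w z) z) :
    ∃ M : ℝ, ∀ z : ℝ, (m : ℝ) / 2 + 1 ≤ z →
      z ^ (-((m : ℝ) / 2)) * w' z ^ 2 + z ^ ((m : ℝ) / 2) * w z ^ 2 ≤ M := by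
  set k : ℝ := (m : ℝ) / 2 with hk
  have hk0 : 0 ≤ k := by positivity
  set E : ℝ → ℝ := fun z => z ^ (-k) * w' z ^ 2 + z ^ k * w z ^ 2 with hE
  set F : ℝ → ℝ := fun z => E z + k * z ^ (-k - 1) * (w z * w' z) with hF
  set K : ℝ := k * (k + 1) with hK
  have hF' : ∀ z : ℝ, 0 < z →
      HasDerivAt F (-(K * z ^ (-k - 2) * (w z * w' z))) z := by
    intro z hz
    have ha := Real.hasDerivAt_rpow_const (p := k) (Or.inl hz.ne')
    have hb := Real.hasDerivAt_rpow_const (p := -k) (Or.inl hz.ne')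
    have hc := Real.hasDerivAt_rpow_const (p := -k - 1) (Or.inl hz.ne')
    have := ((hb.mul ((hw' z).pow 2)).add (ha.mul ((hw z).pow 2))).add
      ((hc.const_mul k).mul ((hw z).mul (hw' z)))
    refine this.congr_deriv ?_
    have e1 : z ^ k = z ^ (-k) * z ^ m := by
      rw [← Real.rpow_natCast z m, ← Real.rpow_add hz]; congr 1; rw [hk]; ring
    have e2 : z ^ (k - 1) = z ^ (-k - 1) * z ^ m := by
      rw [← Real.rpow_natCast z m, ← Real.rpow_add hz]; congr 1; rw [hk]; ring
    have e3 : z ^ (-k - 1 - 1) = z ^ (-k - 2) := by congr 1; ring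
    simp only [Pi.pow_apply, Pi.mul_apply]
    rw [e1, e2, e3, hK]
    push_cast
    ring
  have hww : ∀ z : ℝ, 0 < z → |w z * w' z| ≤ E z / 2 := by
    intro z hz
    have e : z ^ (-k) * z ^ k = 1 := by rw [← Real.rpow_add hz]; simp
    have hp : 0 < z ^ k := by positivity
    have hq : z ^ (-k) = (z ^ k)⁻¹ := Real.rpow_neg hz.le k
    have h1 : E z = (z ^ k)⁻¹ * (|w' z| ^ 2 + (z ^ k * |w z|) ^ 2) := by
      simp only [hE, hq, mul_pow, sq_abs]; field_simp
    have h2 : |w z * w' z| = (z ^ k)⁻¹ * ((z ^ k * |w z|) * |w' z|) := by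
      rw [abs_mul]; field_simp
    rw [h1, h2, mul_div_assoc]
    gcongr
    nlinarith [sq_nonneg (|w' z| - z ^ k * |w z|)]
  have hEF : ∀ z : ℝ, k + 1 ≤ z → E z ≤ 2 * F z := by
    intro z hz
    have hz0 : 0 < z := by linarith
    have h1 : k * z ^ (-k - 1) ≤ 1 := by
      have : z ^ (-k - 1) ≤ z ^ (-1 : ℝ) :=
        Real.rpow_le_rpow_of_exponent_le (by linarith) (by linarith)
      rw [Real.rpow_neg_one] at this
      calc k * z ^ (-k - 1) ≤ k * z⁻¹ := by gcongr
        _ ≤ 1 := by rw [mul_inv_le_iff₀ hz0]; linarith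
    have h2 : |k * z ^ (-k - 1) * (w z * w' z)| ≤ 1 * (E z / 2) := by
      rw [abs_mul, abs_of_nonneg (a := k * _) (by positivity)]
      exact mul_le_mul h1 (hww z hz0) (abs_nonneg _) zero_le_one
    have h3 := neg_abs_le (k * z ^ (-k - 1) * (w z * w' z))
    simp only [hF]
    linarith
  -- The weight `exp (K / z)` absorbs `F' ≤ K z⁻² F`.
  have hG' : ∀ z : ℝ, 0 < z → HasDerivAt (fun z => F z * Real.exp (K * z⁻¹))
      ((-(K * z ^ (-k - 2) * (w z * w' z)) - K * z ^ (-2 : ℝ) * F z) * Real.exp (K * z⁻¹)) z := by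
    intro z hz
    have := (hF' z hz).mul (((hasDerivAt_inv hz.ne').const_mul K).exp)
    refine this.congr_deriv ?_
    have : z ^ (-2 : ℝ) = (z ^ 2)⁻¹ := by
      rw [Real.rpow_neg hz.le]; norm_num
    rw [this]; ring
  have hanti : AntitoneOn (fun z => F z * Real.exp (K * z⁻¹)) (Ici (k + 1)) := by
    refine antitoneOn_of_deriv_nonpos (convex_Ici _) (fun z hz => ?_) (fun z hz => ?_)
      (fun z hz => ?_)
    · have : 0 < z := by have := mem_Ici.mp hz; linarith
      exact (hG' z this).continuousAt.continuousWithinAt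
    · rw [interior_Ici] at hz
      have : 0 < z := by have := mem_Ioi.mp hz; linarith
      exact (hG' z this).differentiableAt.differentiableWithinAt
    · rw [interior_Ici] at hz
      have hz1 : k + 1 ≤ z := (mem_Ioi.mp hz).le
      have hz0 : 0 < z := by linarith
      rw [(hG' z hz0).deriv]
      refine mul_nonpos_of_nonpos_of_nonneg ?_ (Real.exp_nonneg _)
      have h1 : -(w z * w' z) ≤ E z / 2 := (neg_le_abs _).trans (hww z hz0)
      have h2 : z ^ (-k - 2) ≤ z ^ (-2 : ℝ) :=
        Real.rpow_le_rpow_of_exponent_le (by linarith) (by linarith)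
      have h3 : E z / 2 ≤ F z := by linarith [hEF z hz1]
      have h0 : 0 ≤ E z / 2 := (abs_nonneg _).trans (hww z hz0)
      have hK0 : 0 ≤ K := by positivity
      have : K * z ^ (-k - 2) * -(w z * w' z) ≤ K * z ^ (-2 : ℝ) * F z :=
        calc K * z ^ (-k - 2) * -(w z * w' z) ≤ K * z ^ (-k - 2) * (E z / 2) := by gcongr
          _ ≤ K * z ^ (-2 : ℝ) * F z := by gcongr
      linarith
  refine ⟨2 * (F (k + 1) * Real.exp (K * (k + 1)⁻¹)), fun z hz => ?_⟩
  have hz0 : 0 < z := by linarith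
  have h1 := hanti (mem_Ici.mpr le_rfl) (mem_Ici.mpr hz) hz
  simp only at h1
  have h2 : E z ≤ 2 * F z := hEF z hz
  have h0 : 0 ≤ E z / 2 := (abs_nonneg _).trans (hww z hz0)
  have h3 : F z * 1 ≤ F z * Real.exp (K * z⁻¹) :=
    mul_le_mul_of_nonneg_left (Real.one_le_exp (by positivity)) (by linarith)
  change E z ≤ _
  linarith

/-- Solutions of `w'' + z ^ m w = 0` decay like `z ^ (-m/4)`, and their derivatives grow at most
like `z ^ (m/4)`. -/
theorem exists_wkb_bound {m : ℕ} {w w' : ℝ → ℝ} (hw : ∀ z, HasDerivAt w (w' z) z)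
    (hw' : ∀ z, HasDerivAt w' (-z ^ m * w z) z) :
    ∃ C : ℝ, 0 < C ∧ ∀ z : ℝ, 0 ≤ z →
      |w z| * (1 + z) ^ ((m : ℝ) / 4) ≤ C ∧ |w' z| ≤ C * (1 + z) ^ ((m : ℝ) / 4) := by
  obtain ⟨M, hM⟩ := exists_energy_le hw hw'
  have hwc : Continuous w := continuous_iff_continuousAt.mpr fun z => (hw z).continuousAt
  have hwc' : Continuous w' := continuous_iff_continuousAt.mpr fun z => (hw' z).continuousAt
  have hpc : ContinuousOn (fun z : ℝ => (1 + z) ^ ((m : ℝ) / 4)) (Icc 0 ((m : ℝ) / 2 + 1)) :=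
    ContinuousOn.rpow_const (by fun_prop) fun z _ => Or.inr (by positivity)
  obtain ⟨B, hB⟩ :=
    (isCompact_Icc (a := (0 : ℝ)) (b := (m : ℝ) / 2 + 1)).exists_bound_of_continuousOn
    (f := fun z => |w z| * (1 + z) ^ ((m : ℝ) / 4)) (hwc.abs.continuousOn.mul hpc)
  obtain ⟨B', hB'⟩ :=
    (isCompact_Icc (a := (0 : ℝ)) (b := (m : ℝ) / 2 + 1)).exists_bound_of_continuousOn
    (f := w') hwc'.continuousOn
  set A : ℝ := 2 ^ ((m : ℝ) / 4) * √M with hA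
  have hA0 : 0 ≤ A := by positivity
  have hsqrt : √M ≤ A :=
    le_mul_of_one_le_left (Real.sqrt_nonneg _) (Real.one_le_rpow (by norm_num) (by positivity))
  refine ⟨|B| + |B'| + A + 1, by positivity, fun z hz => ?_⟩
  have hone : 1 ≤ (1 + z) ^ ((m : ℝ) / 4) := Real.one_le_rpow (by linarith) (by positivity)
  rcases le_total z ((m : ℝ) / 2 + 1) with hz1 | hz1
  · have h1 := (le_abs_self _).trans (hB z ⟨hz, hz1⟩)
    have h2 := hB' z ⟨hz, hz1⟩
    rw [Real.norm_eq_abs] at h2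
    refine ⟨by linarith [le_abs_self B, abs_nonneg B'], ?_⟩
    calc |w' z| ≤ |B| + |B'| + A + 1 := by linarith [le_abs_self B', abs_nonneg B]
      _ ≤ _ := le_mul_of_one_le_right (by positivity) hone
  · have hz1' : 1 ≤ z := by
      have : (0 : ℝ) ≤ (m : ℝ) / 2 := by positivity
      linarith
    have hz0 : 0 < z := by linarith
    have hE := hM z hz1
    have e1 : z ^ ((m : ℝ) / 2) = (z ^ ((m : ℝ) / 4)) ^ 2 := by
      rw [← Real.rpow_natCast, ← Real.rpow_mul hz]; congr 1; push_cast; ring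
    have hp : 0 < z ^ ((m : ℝ) / 4) := by positivity
    rw [Real.rpow_neg hz, e1] at hE
    have h1 : |w z| * z ^ ((m : ℝ) / 4) ≤ √M := by
      apply Real.le_sqrt_of_sq_le
      have : 0 ≤ ((z ^ ((m : ℝ) / 4)) ^ 2)⁻¹ * w' z ^ 2 := by positivity
      rw [mul_pow, sq_abs]; linarith
    have h2 : |w' z| ≤ √M * z ^ ((m : ℝ) / 4) := by
      rw [← div_le_iff₀ hp]
      apply Real.le_sqrt_of_sq_le
      have : 0 ≤ (z ^ ((m : ℝ) / 4)) ^ 2 * w z ^ 2 := by positivity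
      rw [div_pow, sq_abs, div_eq_inv_mul]; linarith
    constructor
    · calc |w z| * (1 + z) ^ ((m : ℝ) / 4) ≤ |w z| * (2 * z) ^ ((m : ℝ) / 4) := by
            gcongr; linarith
        _ = 2 ^ ((m : ℝ) / 4) * (|w z| * z ^ ((m : ℝ) / 4)) := by
            rw [Real.mul_rpow (by norm_num) hz]; ring
        _ ≤ A := by rw [hA]; gcongr
        _ ≤ _ := by linarith [abs_nonneg B, abs_nonneg B']
    · calc |w' z| ≤ √M * z ^ ((m : ℝ) / 4) := h2
        _ ≤ (|B| + |B'| + A + 1) * (1 + z) ^ ((m : ℝ) / 4) := by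
          gcongr
          · linarith [abs_nonneg B, abs_nonneg B']
          · linarith

/-! ### Multiplication operators on `L²` depending on a parameter -/

section Multiplication

open Filter Topology

variable {α : Type*} [MeasurableSpace α] {μ : Measure α}

open Classical in
/-- Multiplication of an `L²` function by a real function. The value is `0` if the product is not in
`L²`, which cannot happen for bounded measurable multipliers. -/
noncomputable def lpMul (a : α → ℝ) (f : Lp ℂ 2 μ) : Lp ℂ 2 μ :=
  if h : MemLp (fun x => a x • f x) 2 μ then h.toLp _ else 0

theorem memLp_smul_of_abs_le {a : α → ℝ} (ha : Measurable a) {C : ℝ} (hC : ∀ x, |a x| ≤ C)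
    (f : Lp ℂ 2 μ) : MemLp (fun x => a x • f x) 2 μ := by
  refine (Lp.memLp f).of_le_mul (c := C)
    (ha.aestronglyMeasurable.smul (Lp.aestronglyMeasurable f)) (ae_of_all _ fun x => ?_)
  rw [norm_smul, Real.norm_eq_abs]
  exact mul_le_mul_of_nonneg_right (hC x) (norm_nonneg _)

theorem coeFn_lpMul {a : α → ℝ} (ha : Measurable a) {C : ℝ} (hC : ∀ x, |a x| ≤ C)
    (f : Lp ℂ 2 μ) : lpMul a f =ᵐ[μ] fun x => a x • f x := by
  have h := memLp_smul_of_abs_le ha hC f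
  rw [lpMul, dif_pos h]
  exact h.coeFn_toLp

theorem norm_lpMul_le {a : α → ℝ} (ha : Measurable a) {C : ℝ} (hC : ∀ x, |a x| ≤ C)
    (f : Lp ℂ 2 μ) : ‖lpMul a f‖ ≤ C * ‖f‖ := by
  refine Lp.norm_le_mul_norm_of_ae_le_mul ?_
  filter_upwards [coeFn_lpMul ha hC f] with x hx
  rw [hx, norm_smul, Real.norm_eq_abs]
  exact mul_le_mul_of_nonneg_right (hC x) (norm_nonneg _)

theorem lpMul_sub {a b : α → ℝ} (ha : Measurable a) (hb : Measurable b) {C D : ℝ}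
    (hC : ∀ x, |a x| ≤ C) (hD : ∀ x, |b x| ≤ D) (f : Lp ℂ 2 μ) :
    lpMul a f - lpMul b f = lpMul (fun x => a x - b x) f := by
  have hab : ∀ x, |a x - b x| ≤ C + D := fun x =>
    (abs_sub _ _).trans (add_le_add (hC x) (hD x))
  apply Lp.ext
  filter_upwards [coeFn_lpMul ha hC f, coeFn_lpMul hb hD f, coeFn_lpMul (ha.sub hb) hab f,
    Lp.coeFn_sub (lpMul a f) (lpMul b f)] with x h1 h2 h3 h4
  rw [h4, Pi.sub_apply, h1, h2]
  exact (sub_smul _ _ _).symm.trans h3.symm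

theorem lpMul_const_smul {a : α → ℝ} (ha : Measurable a) {C : ℝ} (hC : ∀ x, |a x| ≤ C) (c : ℝ)
    (f : Lp ℂ 2 μ) : c • lpMul a f = lpMul (fun x => c * a x) f := by
  have hca : ∀ x, |c * a x| ≤ |c| * C := fun x => by
    rw [abs_mul]; exact mul_le_mul_of_nonneg_left (hC x) (abs_nonneg c)
  apply Lp.ext
  filter_upwards [coeFn_lpMul ha hC f, coeFn_lpMul (ha.const_mul c) hca f,
    Lp.coeFn_smul c (lpMul a f)] with x h1 h2 h3
  rw [h3, Pi.smul_apply, h1, h2, mul_smul]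

/-- Dominated convergence for multiplication operators: bounded multipliers that tend to `0`
pointwise tend to `0` strongly on `L²`. -/
theorem tendsto_lpMul_zero {ι : Type*} {l : Filter ι} [l.IsCountablyGenerated]
    {a : ι → α → ℝ} {C : ℝ} (ha : ∀ᶠ i in l, Measurable (a i)) (hC : ∀ᶠ i in l, ∀ x, |a i x| ≤ C)
    (hlim : ∀ x, Tendsto (fun i => a i x) l (𝓝 0)) (f : Lp ℂ 2 μ) :
    Tendsto (fun i => lpMul (a i) f) l (𝓝 0) := by
  have hnorm : ∀ g : Lp ℂ 2 μ, ‖g‖ = √(∫ x, ‖g x‖ ^ 2 ∂μ) := fun g => by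
    have h : ‖g‖ ^ 2 = ∫ x, ‖g x‖ ^ 2 ∂μ := by
      rw [← inner_self_eq_norm_sq (𝕜 := ℂ), L2.inner_def, ← integral_re]
      · simp only [inner_self_eq_norm_sq]
      · exact L2.integrable_inner g g
    rw [← h, Real.sqrt_sq (norm_nonneg _)]
  rw [tendsto_zero_iff_norm_tendsto_zero]
  simp_rw [hnorm]
  have key : Tendsto (fun i => ∫ x, ‖lpMul (a i) f x‖ ^ 2 ∂μ) l (𝓝 (∫ _, (0 : ℝ) ∂μ)) := by
    have hcongr : (fun i => ∫ x, ‖a i x • f x‖ ^ 2 ∂μ) =ᶠ[l]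
        fun i => ∫ x, ‖lpMul (a i) f x‖ ^ 2 ∂μ := by
      filter_upwards [ha, hC] with i hi hi'
      refine integral_congr_ae ?_
      filter_upwards [coeFn_lpMul hi hi' f] with x hx
      rw [hx]
    refine Tendsto.congr' hcongr ?_
    refine tendsto_integral_filter_of_dominated_convergence (fun x => C ^ 2 * ‖f x‖ ^ 2) ?_ ?_ ?_ ?_
    · filter_upwards [ha] with i hi
      exact (hi.aestronglyMeasurable.smul (Lp.aestronglyMeasurable f)).norm.pow 2
    · filter_upwards [hC] with i hi
      refine ae_of_all _ fun x => ?_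
      rw [norm_pow, norm_norm, norm_smul, mul_pow, Real.norm_eq_abs]
      gcongr
      exact hi x
    · exact ((memLp_two_iff_integrable_sq_norm (Lp.aestronglyMeasurable f)).mp
        (Lp.memLp f)).const_mul _
    · refine ae_of_all _ fun x => ?_
      simpa using (((hlim x).smul_const (f x)).norm).pow 2
  rw [integral_zero] at key
  simpa using key.sqrt

/-- A family of multipliers that is continuous in the parameter, and bounded locally uniformly in
it, acts strongly continuously on `L²`. -/
theorem continuousOn_lpMul {S : Set ℝ} {a : ℝ → α → ℝ} {B : ℝ → ℝ}
    (ha : ∀ t ∈ S, Measurable (a t)) (hB : ContinuousOn B S) (haB : ∀ t ∈ S, ∀ x, |a t x| ≤ B t)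
    (hac : ∀ x, ContinuousOn (fun t => a t x) S) (f : Lp ℂ 2 μ) :
    ContinuousOn (fun t => lpMul (a t) f) S := by
  intro t ht
  rw [ContinuousWithinAt, ← tendsto_sub_nhds_zero_iff]
  have hbound : ∀ᶠ t' in 𝓝[S] t, B t' ≤ B t + 1 :=
    ((hB t ht).eventually (gt_mem_nhds (lt_add_one (B t)))).mono fun _ h => h.le
  have hcongr : (fun t' => lpMul (fun x => a t' x - a t x) f) =ᶠ[𝓝[S] t]
      fun t' => lpMul (a t') f - lpMul (a t) f := by
    filter_upwards [self_mem_nhdsWithin] with t' ht'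
    exact (lpMul_sub (ha t' ht') (ha t ht) (haB t' ht') (haB t ht) f).symm
  refine Tendsto.congr' hcongr (tendsto_lpMul_zero (C := (B t + 1) + B t) ?_ ?_ ?_ f)
  · filter_upwards [self_mem_nhdsWithin] with t' ht'
    exact (ha t' ht').sub (ha t ht)
  · filter_upwards [self_mem_nhdsWithin, hbound] with t' ht' hb x
    exact (abs_sub _ _).trans (add_le_add ((haB t' ht' x).trans hb) (haB t ht x))
  · intro x
    exact tendsto_sub_nhds_zero_iff.mpr (hac x t ht)

/-- A family of multipliers that is differentiable in the parameter, with derivative bounded locally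
uniformly in it, acts strongly differentiably on `L²`. -/
theorem hasDerivWithinAt_lpMul {S : Set ℝ} (hS : Convex ℝ S) {p p' : ℝ → α → ℝ} {B B' : ℝ → ℝ}
    (hp : ∀ t ∈ S, Measurable (p t)) (hp' : ∀ t ∈ S, Measurable (p' t))
    (hB' : ContinuousOn B' S) (hpB : ∀ t ∈ S, ∀ x, |p t x| ≤ B t)
    (hpB' : ∀ t ∈ S, ∀ x, |p' t x| ≤ B' t)
    (hderiv : ∀ x, ∀ t ∈ S, HasDerivWithinAt (fun t => p t x) (p' t x) S t) (f : Lp ℂ 2 μ)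
    {t : ℝ} (ht : t ∈ S) :
    HasDerivWithinAt (fun t => lpMul (p t) f) (lpMul (p' t) f) S t := by
  rw [hasDerivWithinAt_iff_tendsto_slope, ← tendsto_sub_nhds_zero_iff]
  have hbound : ∀ᶠ t' in 𝓝[S] t, B' t' ≤ B' t + 1 :=
    ((hB' t ht).eventually (gt_mem_nhds (lt_add_one (B' t)))).mono fun _ h => h.le
  obtain ⟨δ, hδ, hδB⟩ := Metric.mem_nhdsWithin_iff.mp hbound
  have hmeas : ∀ t' ∈ S, Measurable fun x => (t' - t)⁻¹ * (p t' x - p t x) := fun t' ht' =>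
    ((hp t' ht').sub (hp t ht)).const_mul _
  -- The mean value theorem bounds the difference quotients near `t` by the supremum of `p'`.
  have hquot : ∀ t' ∈ Metric.ball t δ ∩ S, ∀ x,
      |(t' - t)⁻¹ * (p t' x - p t x)| ≤ B' t + 1 := by
    intro t' ht' x
    have hconv : Convex ℝ (Metric.ball t δ ∩ S) := (convex_ball t δ).inter hS
    have h := hconv.norm_image_sub_le_of_norm_hasDerivWithin_le (C := B' t + 1)
      (f := fun t => p t x) (f' := fun t => p' t x)
      (fun y hy => (hderiv x y hy.2).mono inter_subset_right)
      (fun y hy => (hpB' y hy.2 x).trans (hδB hy)) ⟨Metric.mem_ball_self hδ, ht⟩ ht'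
    rw [Real.norm_eq_abs, Real.norm_eq_abs] at h
    have h0 : 0 ≤ B' t + 1 :=
      (abs_nonneg _).trans ((hpB' t ht x).trans (by linarith))
    rw [abs_mul, abs_inv]
    rcases eq_or_ne t' t with rfl | hne
    · simpa using h0
    · rw [inv_mul_le_iff₀ (abs_pos.mpr (sub_ne_zero.mpr hne)), mul_comm]
      exact h
  have hmem : ∀ᶠ t' in 𝓝[S \ {t}] t, t' ∈ Metric.ball t δ ∩ S := by
    have h1 : ∀ᶠ t' in 𝓝[S \ {t}] t, t' ∈ Metric.ball t δ :=
      mem_nhdsWithin_of_mem_nhds (Metric.ball_mem_nhds t hδ)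
    filter_upwards [h1, self_mem_nhdsWithin] with t' h h'
    exact ⟨h, h'.1⟩
  have hcongr : (fun t' => lpMul (fun x => (t' - t)⁻¹ * (p t' x - p t x) - p' t x) f)
      =ᶠ[𝓝[S \ {t}] t] fun t' => slope (fun t => lpMul (p t) f) t t' - lpMul (p' t) f := by
    filter_upwards [hmem] with t' ht'
    have hsub : ∀ x, |p t' x - p t x| ≤ B t' + B t := fun x =>
      (abs_sub _ _).trans (add_le_add (hpB t' ht'.2 x) (hpB t ht x))
    rw [slope_def_module, lpMul_sub (hp t' ht'.2) (hp t ht) (hpB t' ht'.2) (hpB t ht),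
      lpMul_const_smul (a := fun x => p t' x - p t x) ((hp t' ht'.2).sub (hp t ht)) hsub,
      lpMul_sub (hmeas t' ht'.2) (hp' t ht) (hquot t' ht') (hpB' t ht)]
  refine Tendsto.congr' hcongr (tendsto_lpMul_zero (C := (B' t + 1) + B' t) ?_ ?_ ?_ f)
  · filter_upwards [hmem] with t' ht'
    exact (hmeas t' ht'.2).sub (hp' t ht)
  · filter_upwards [hmem] with t' ht' x
    exact (abs_sub _ _).trans (add_le_add (hquot t' ht' x) (hpB' t ht x))
  · intro x
    have h := (hasDerivWithinAt_iff_tendsto_slope.mp (hderiv x t ht))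
    simpa [slope_def_module] using tendsto_sub_nhds_zero_iff.mpr h

end Multiplication

/-! ### Sobolev spaces on the Fourier side -/

section Sobolev

open FourierTransform TemperedDistribution

variable {n : ℕ}

/-- The weight `(1 + |ξ|²)^(r/2)`. -/
noncomputable def bracket (r : ℝ) (ξ : EuclideanSpace ℝ (Fin n)) : ℝ := (1 + ‖ξ‖ ^ 2) ^ (r / 2)

theorem bracket_pos (r : ℝ) (ξ : EuclideanSpace ℝ (Fin n)) : 0 < bracket r ξ := by
  unfold bracket; positivity

theorem bracket_add (r r' : ℝ) (ξ : EuclideanSpace ℝ (Fin n)) :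
    bracket (r + r') ξ = bracket r ξ * bracket r' ξ := by
  rw [bracket, bracket, bracket, add_div, Real.rpow_add (by positivity)]

theorem bracket_mul (r y : ℝ) (ξ : EuclideanSpace ℝ (Fin n)) :
    bracket (r * y) ξ = bracket r ξ ^ y := by
  rw [bracket, bracket, ← Real.rpow_mul (by positivity)]
  congr 1; ring

theorem bracket_zero (ξ : EuclideanSpace ℝ (Fin n)) : bracket 0 ξ = 1 := by
  simp [bracket]

theorem bracket_le_one {r : ℝ} (hr : r ≤ 0) (ξ : EuclideanSpace ℝ (Fin n)) :
    bracket r ξ ≤ 1 :=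
  Real.rpow_le_one_of_one_le_of_nonpos (by simp) (by linarith)

theorem measurable_bracket (r : ℝ) :
    Measurable (bracket r : EuclideanSpace ℝ (Fin n) → ℝ) := by
  unfold bracket; fun_prop

namespace SobolevSpace

/-- The element of `H^r` whose Bessel potential of order `r` is a given `L²` function. -/
noncomputable def ofL2 (r : ℝ) (h : Lp ℂ 2 (volume : Measure (EuclideanSpace ℝ (Fin n)))) :
    SobolevSpace n r :=
  (⟨besselPotential _ ℂ (-r) (h : 𝓢'(EuclideanSpace ℝ (Fin n), ℂ)), h, by simp⟩ :
    sobolevSubmodule n r)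

theorem toDistribution_ofL2 (r : ℝ) (h : Lp ℂ 2 (volume : Measure (EuclideanSpace ℝ (Fin n)))) :
    toDistribution (ofL2 r h) =
      besselPotential _ ℂ (-r) (h : 𝓢'(EuclideanSpace ℝ (Fin n), ℂ)) :=
  rfl

theorem toL2_ofL2 (r : ℝ) (h : Lp ℂ 2 (volume : Measure (EuclideanSpace ℝ (Fin n)))) :
    toL2 (ofL2 r h) = h := by
  apply coe_L2_injective
  rw [← besselPotential_eq, toDistribution_ofL2]
  simp

/-- The isometry `L² → H^r` that maps `g` to the distribution with Fourier transform
`(1 + |ξ|²)^(-r/2) g`. -/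
noncomputable def ofFourier (r : ℝ) :
    Lp ℂ 2 (volume : Measure (EuclideanSpace ℝ (Fin n))) →ₗᵢ[ℂ] SobolevSpace n r where
  toFun g := ofL2 r (𝓕⁻ g)
  map_add' f g := by
    apply toL2_injective
    rw [map_add, toL2_ofL2, toL2_ofL2, toL2_ofL2, FourierTransform.fourierInv_add]
  map_smul' c g := by
    apply toL2_injective
    rw [map_smul, toL2_ofL2, toL2_ofL2, FourierTransform.fourierInv_smul, RingHom.id_apply]
  norm_map' g := by
    change ‖ofL2 r (𝓕⁻ g)‖ = ‖g‖
    rw [norm_eq, toL2_ofL2, ← Lp.norm_fourier_eq, fourier_fourierInv_eq]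

theorem toDistribution_ofFourier (r : ℝ)
    (g : Lp ℂ 2 (volume : Measure (EuclideanSpace ℝ (Fin n)))) :
    toDistribution (ofFourier r g) = besselPotential _ ℂ (-r) ((𝓕⁻ g :
      Lp ℂ 2 (volume : Measure (EuclideanSpace ℝ (Fin n)))) : 𝓢'(EuclideanSpace ℝ (Fin n), ℂ)) :=
  rfl

theorem toDistribution_ofFourier_apply (r : ℝ)
    (g : Lp ℂ 2 (volume : Measure (EuclideanSpace ℝ (Fin n))))
    (ψ : 𝓢(EuclideanSpace ℝ (Fin n), ℂ)) :
    toDistribution (ofFourier r g) ψ = ∫ ξ, 𝓕⁻ ψ ξ * (bracket (-r) ξ • g ξ) := by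
  rw [toDistribution_ofFourier, besselPotential, fourierMultiplierCLM_apply_apply,
    ← Lp.fourierInv_toTemperedDistribution_eq, TemperedDistribution.fourierInv_apply,
    fourierInv_fourier_eq, Lp.toTemperedDistribution_apply]
  refine integral_congr_ae (ae_of_all _ fun ξ => ?_)
  simp only
  rw [SchwartzMap.smulLeftCLM_apply_apply (by fun_prop), bracket, Complex.real_smul, smul_eq_mul,
    smul_eq_mul]
  ring

theorem ofFourier_fourier_toL2 (r : ℝ) (f : SobolevSpace n r) :
    ofFourier r (𝓕 (toL2 f)) = f := by
  apply toL2_injective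
  change toL2 (ofL2 r (𝓕⁻ (𝓕 (toL2 f)))) = toL2 f
  rw [toL2_ofL2, fourierInv_fourier_eq]

theorem toDistribution_ofFourier_eq_of_ae {r r' : ℝ}
    {g g' : Lp ℂ 2 (volume : Measure (EuclideanSpace ℝ (Fin n)))}
    (h : ∀ᵐ ξ, bracket (-r) ξ • g ξ = bracket (-r') ξ • g' ξ) :
    toDistribution (ofFourier r g) = toDistribution (ofFourier r' g') := by
  ext ψ
  rw [toDistribution_ofFourier_apply, toDistribution_ofFourier_apply]
  refine integral_congr_ae ?_
  filter_upwards [h] with ξ hξ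
  rw [hξ]

theorem laplacian_toDistribution_ofFourier_apply (r : ℝ)
    (g : Lp ℂ 2 (volume : Measure (EuclideanSpace ℝ (Fin n))))
    (ψ : 𝓢(EuclideanSpace ℝ (Fin n), ℂ)) :
    (Δ (toDistribution (ofFourier r g))) ψ =
      ∫ ξ, 𝓕⁻ ψ ξ * ((-(2 * Real.pi * ‖ξ‖) ^ 2 * bracket (-r) ξ) • g ξ) := by
  rw [TemperedDistribution.laplacian_eq_fourierMultiplierCLM]
  change (-(2 * Real.pi) ^ 2 : ℝ) • (fourierMultiplierCLM ℂ _ _ ψ) = _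
  rw [fourierMultiplierCLM_apply_apply, toDistribution_ofFourier_apply, fourierInv_fourier_eq,
    ← integral_smul]
  refine integral_congr_ae (ae_of_all _ fun ξ => ?_)
  simp only
  rw [SchwartzMap.smulLeftCLM_apply_apply (by fun_prop)]
  simp only [Complex.real_smul, smul_eq_mul]
  push_cast
  ring

/-- Evaluation of an element of `H^r`, given by its weighted Fourier transform in `L²`, at a
Schwartz function. -/
noncomputable def pairing (r : ℝ) (ψ : 𝓢(EuclideanSpace ℝ (Fin n), ℂ)) :
    Lp ℂ 2 (volume : Measure (EuclideanSpace ℝ (Fin n))) →L[ℂ] ℂ where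
  toFun g := toDistribution (ofFourier r g) ψ
  map_add' f g := by rw [map_add, map_add]; rfl
  map_smul' c g := by rw [map_smul, map_smul]; rfl
  cont := by
    have h := (besselPotential (EuclideanSpace ℝ (Fin n)) ℂ (-r)).continuous.comp
      ((Lp.toTemperedDistributionCLM ℂ
        (volume : Measure (EuclideanSpace ℝ (Fin n))) 2).continuous.comp
        (Lp.fourierTransformₗᵢ (EuclideanSpace ℝ (Fin n)) ℂ).symm.continuous)
    exact (PointwiseConvergenceCLM.evalCLM (RingHom.id ℂ) ℂ ψ).continuous.comp h

end SobolevSpace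

end Sobolev

/-! ### Fourier multipliers between Sobolev spaces -/

section Multiplier

open FourierTransform TemperedDistribution

variable {n : ℕ} {s : ℝ}

namespace SobolevSpace

/-- The Fourier multiplier with symbol `p`, as a map `H^s → H^r`. It is meaningful when `p` is
measurable and `(1 + |ξ|²)^((r-s)/2) p` is bounded. -/
noncomputable def fourierMul (r : ℝ) (p : EuclideanSpace ℝ (Fin n) → ℝ) (f : SobolevSpace n s) :
    SobolevSpace n r :=
  ofFourier r (lpMul (fun ξ => bracket (r - s) ξ * p ξ) (𝓕 (toL2 f)))

theorem norm_fourierMul_le {r C : ℝ} {p : EuclideanSpace ℝ (Fin n) → ℝ} (hp : Measurable p)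
    (hC : ∀ ξ, |bracket (r - s) ξ * p ξ| ≤ C) (f : SobolevSpace n s) :
    ‖fourierMul r p f‖ ≤ C * ‖f‖ := by
  rw [fourierMul, LinearIsometry.norm_map, norm_eq, ← Lp.norm_fourier_eq (toL2 f)]
  exact norm_lpMul_le ((measurable_bracket _).mul hp) hC _

theorem bracket_smul_lpMul {r C : ℝ} {p : EuclideanSpace ℝ (Fin n) → ℝ} (hp : Measurable p)
    (hC : ∀ ξ, |bracket (r - s) ξ * p ξ| ≤ C)
    (g : Lp ℂ 2 (volume : Measure (EuclideanSpace ℝ (Fin n)))) :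
    ∀ᵐ ξ, bracket (-r) ξ • lpMul (fun ξ => bracket (r - s) ξ * p ξ) g ξ =
      (bracket (-s) ξ * p ξ) • g ξ := by
  filter_upwards [coeFn_lpMul (a := fun ξ => bracket (r - s) ξ * p ξ)
    ((measurable_bracket (r - s)).mul hp) hC g] with ξ hξ
  rw [hξ, smul_smul, ← mul_assoc, ← bracket_add, show -r + (r - s) = -s by ring]

/-- The distribution does not depend on the Sobolev space in which the multiplier takes values. -/
theorem toDistribution_fourierMul_congr {r r' C C' : ℝ} {p : EuclideanSpace ℝ (Fin n) → ℝ}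
    (hp : Measurable p) (hC : ∀ ξ, |bracket (r - s) ξ * p ξ| ≤ C)
    (hC' : ∀ ξ, |bracket (r' - s) ξ * p ξ| ≤ C') (f : SobolevSpace n s) :
    toDistribution (fourierMul r p f) = toDistribution (fourierMul r' p f) := by
  apply toDistribution_ofFourier_eq_of_ae
  filter_upwards [bracket_smul_lpMul hp hC (𝓕 (toL2 f)), bracket_smul_lpMul hp hC' (𝓕 (toL2 f))]
    with ξ h h'
  rw [h, h']

theorem toDistribution_fourierMul_one {r : ℝ} (hr : r ≤ s) (f : SobolevSpace n s) :
    toDistribution (fourierMul r (fun _ => 1) f) = toDistribution f := by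
  have hb : ∀ ξ : EuclideanSpace ℝ (Fin n), |bracket (r - s) ξ * 1| ≤ 1 := fun ξ => by
    rw [mul_one, abs_of_pos (bracket_pos _ _)]
    exact bracket_le_one (by linarith) ξ
  conv_rhs => rw [← ofFourier_fourier_toL2 s f]
  apply toDistribution_ofFourier_eq_of_ae
  filter_upwards [bracket_smul_lpMul (p := fun _ => 1) measurable_const hb (𝓕 (toL2 f))] with ξ h
  rw [h, mul_one]

theorem toDistribution_fourierMul_zero {r : ℝ} (f : SobolevSpace n s) :
    toDistribution (fourierMul r (fun _ => 0) f) = 0 := by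
  have h : fourierMul r (fun _ => 0) f = 0 := by
    rw [← norm_le_zero_iff]
    simpa using norm_fourierMul_le (r := r) (C := 0) measurable_const (by simp) f
  rw [h, map_zero]

theorem laplacian_toDistribution_fourierMul {r C C' : ℝ} {p : EuclideanSpace ℝ (Fin n) → ℝ}
    (hp : Measurable p) (hC : ∀ ξ, |bracket (r - s) ξ * p ξ| ≤ C)
    (c : ℝ) (hC' : ∀ ξ, |bracket (r - s) ξ * (-((2 * Real.pi * ‖ξ‖) ^ 2 * c * p ξ))| ≤ C')
    (f : SobolevSpace n s) (ψ : 𝓢(EuclideanSpace ℝ (Fin n), ℂ)) :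
    toDistribution (fourierMul r (fun ξ => -((2 * Real.pi * ‖ξ‖) ^ 2 * c * p ξ)) f) ψ =
      (c : ℂ) * (Δ (toDistribution (fourierMul r p f))) ψ := by
  rw [fourierMul, fourierMul, laplacian_toDistribution_ofFourier_apply,
    toDistribution_ofFourier_apply, ← integral_const_mul]
  refine integral_congr_ae ?_
  have hm : Measurable fun ξ : EuclideanSpace ℝ (Fin n) =>
      -((2 * Real.pi * ‖ξ‖) ^ 2 * c * p ξ) := by fun_prop
  filter_upwards [bracket_smul_lpMul hp hC (𝓕 (toL2 f)), bracket_smul_lpMul hm hC' (𝓕 (toL2 f))]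
    with ξ h h'
  rw [h', mul_smul _ (bracket (-r) ξ), h]
  simp only [Complex.real_smul]
  push_cast
  ring

theorem continuousOn_fourierMul {S : Set ℝ} {r : ℝ} {p : ℝ → EuclideanSpace ℝ (Fin n) → ℝ}
    {B : ℝ → ℝ} (hp : ∀ t ∈ S, Measurable (p t)) (hB : ContinuousOn B S)
    (hpB : ∀ t ∈ S, ∀ ξ, |bracket (r - s) ξ * p t ξ| ≤ B t)
    (hpc : ∀ ξ, ContinuousOn (fun t => p t ξ) S) (f : SobolevSpace n s) :
    ContinuousOn (fun t => fourierMul r (p t) f) S :=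
  (ofFourier r).continuous.comp_continuousOn
    (continuousOn_lpMul (fun t ht => (measurable_bracket _).mul (hp t ht)) hB hpB
      (fun ξ => continuousOn_const.mul (hpc ξ)) _)

theorem hasDerivWithinAt_lpMul_bracket {S : Set ℝ} (hS : Convex ℝ S) {r : ℝ}
    {p p' : ℝ → EuclideanSpace ℝ (Fin n) → ℝ} {B B' : ℝ → ℝ}
    (hp : ∀ t ∈ S, Measurable (p t)) (hp' : ∀ t ∈ S, Measurable (p' t)) (hB' : ContinuousOn B' S)
    (hpB : ∀ t ∈ S, ∀ ξ, |bracket (r - s) ξ * p t ξ| ≤ B t)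
    (hpB' : ∀ t ∈ S, ∀ ξ, |bracket (r - s) ξ * p' t ξ| ≤ B' t)
    (hderiv : ∀ ξ, ∀ t ∈ S, HasDerivWithinAt (fun t => p t ξ) (p' t ξ) S t)
    (g : Lp ℂ 2 (volume : Measure (EuclideanSpace ℝ (Fin n)))) {t : ℝ} (ht : t ∈ S) :
    HasDerivWithinAt (fun t => lpMul (fun ξ => bracket (r - s) ξ * p t ξ) g)
      (lpMul (fun ξ => bracket (r - s) ξ * p' t ξ) g) S t :=
  hasDerivWithinAt_lpMul (p := fun t ξ => bracket (r - s) ξ * p t ξ)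
    (p' := fun t ξ => bracket (r - s) ξ * p' t ξ) hS
    (fun t ht => (measurable_bracket _).mul (hp t ht))
    (fun t ht => (measurable_bracket _).mul (hp' t ht)) hB' hpB hpB'
    (fun ξ t ht => (hderiv ξ t ht).const_mul _) g ht

theorem hasDerivWithinAt_fourierMul {S : Set ℝ} (hS : Convex ℝ S) {r : ℝ}
    {p p' : ℝ → EuclideanSpace ℝ (Fin n) → ℝ} {B B' : ℝ → ℝ}
    (hp : ∀ t ∈ S, Measurable (p t)) (hp' : ∀ t ∈ S, Measurable (p' t)) (hB' : ContinuousOn B' S)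
    (hpB : ∀ t ∈ S, ∀ ξ, |bracket (r - s) ξ * p t ξ| ≤ B t)
    (hpB' : ∀ t ∈ S, ∀ ξ, |bracket (r - s) ξ * p' t ξ| ≤ B' t)
    (hderiv : ∀ ξ, ∀ t ∈ S, HasDerivWithinAt (fun t => p t ξ) (p' t ξ) S t)
    (f : SobolevSpace n s) {t : ℝ} (ht : t ∈ S) :
    HasDerivWithinAt (fun t => fourierMul r (p t) f) (fourierMul r (p' t) f) S t :=
  (((ofFourier (n := n) r).toContinuousLinearMap.restrictScalars ℝ).hasFDerivAt
    |>.comp_hasDerivWithinAt t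
      (hasDerivWithinAt_lpMul_bracket hS hp hp' hB' hpB hpB' hderiv (𝓕 (toL2 f)) ht))

/-- Differentiability in `t` of a family of Fourier multipliers, tested against a Schwartz
function. -/
theorem hasDerivWithinAt_fourierMul_apply {S : Set ℝ} (hS : Convex ℝ S) {r : ℝ}
    {p p' : ℝ → EuclideanSpace ℝ (Fin n) → ℝ} {B B' : ℝ → ℝ}
    (hp : ∀ t ∈ S, Measurable (p t)) (hp' : ∀ t ∈ S, Measurable (p' t)) (hB' : ContinuousOn B' S)
    (hpB : ∀ t ∈ S, ∀ ξ, |bracket (r - s) ξ * p t ξ| ≤ B t)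
    (hpB' : ∀ t ∈ S, ∀ ξ, |bracket (r - s) ξ * p' t ξ| ≤ B' t)
    (hderiv : ∀ ξ, ∀ t ∈ S, HasDerivWithinAt (fun t => p t ξ) (p' t ξ) S t)
    (f : SobolevSpace n s) (ψ : 𝓢(EuclideanSpace ℝ (Fin n), ℂ)) {t : ℝ} (ht : t ∈ S) :
    HasDerivWithinAt (fun t => toDistribution (fourierMul r (p t) f) ψ)
      (toDistribution (fourierMul r (p' t) f) ψ) S t :=
  (((pairing (n := n) r ψ).restrictScalars ℝ).hasFDerivAt
    |>.comp_hasDerivWithinAt t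
      (hasDerivWithinAt_lpMul_bracket hS hp hp' hB' hpB hpB' hderiv (𝓕 (toL2 f)) ht))

end SobolevSpace

end Multiplier

/-! ### The propagators of the Tricomi operator -/

/-- The solution of `y'' + μ ^ (m + 2) t ^ m y = 0`, as a function of `t`, with initial data
`y(0) = 1`, `y'(0) = 0`. -/
noncomputable def propOne (m : ℕ) (t μ : ℝ) : ℝ := airySol m 0 (μ * t)

/-- The derivative of `propOne` in `t`. -/
noncomputable def propOneDeriv (m : ℕ) (t μ : ℝ) : ℝ := μ * airySolDeriv m 0 (μ * t)

/-- The solution of `y'' + μ ^ (m + 2) t ^ m y = 0`, as a function of `t`, with initial data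
`y(0) = 0`, `y'(0) = 1`. -/
noncomputable def propTwo (m : ℕ) (t μ : ℝ) : ℝ := if μ = 0 then t else airySol m 1 (μ * t) / μ

/-- The derivative of `propTwo` in `t`. -/
noncomputable def propTwoDeriv (m : ℕ) (t μ : ℝ) : ℝ := airySolDeriv m 1 (μ * t)

theorem hasDerivAt_propOne (m : ℕ) (t μ : ℝ) :
    HasDerivAt (fun t => propOne m t μ) (propOneDeriv m t μ) t := by
  have h := (hasDerivAt_airySol m 0 (μ * t)).comp t ((hasDerivAt_id t).const_mul μ)
  refine h.congr_deriv ?_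
  rw [propOneDeriv]; ring

theorem hasDerivAt_propOneDeriv (m : ℕ) (t μ : ℝ) :
    HasDerivAt (fun t => propOneDeriv m t μ) (-(μ ^ (m + 2) * t ^ m * propOne m t μ)) t := by
  have h := ((hasDerivAt_airySolDeriv m zero_le_one (μ * t)).comp t
    ((hasDerivAt_id t).const_mul μ)).const_mul μ
  refine h.congr_deriv ?_
  rw [propOne]; ring

theorem hasDerivAt_propTwo (m : ℕ) (t μ : ℝ) :
    HasDerivAt (fun t => propTwo m t μ) (propTwoDeriv m t μ) t := by
  rcases eq_or_ne μ 0 with rfl | hμ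
  · simpa [propTwo, propTwoDeriv, airySolDeriv_one_zero] using hasDerivAt_id' t
  · have h := ((hasDerivAt_airySol m 1 (μ * t)).comp t
      ((hasDerivAt_id t).const_mul μ)).div_const μ
    simp only [propTwo, if_neg hμ]
    refine h.congr_deriv ?_
    rw [propTwoDeriv]; field_simp

theorem hasDerivAt_propTwoDeriv (m : ℕ) (t μ : ℝ) :
    HasDerivAt (fun t => propTwoDeriv m t μ) (-(μ ^ (m + 2) * t ^ m * propTwo m t μ)) t := by
  have h := (hasDerivAt_airySolDeriv m le_rfl (μ * t)).comp t ((hasDerivAt_id t).const_mul μ)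
  refine h.congr_deriv ?_
  rcases eq_or_ne μ 0 with rfl | hμ
  · simp
  · rw [propTwo, if_neg hμ]; field_simp; ring

theorem propOne_zero (m : ℕ) (μ : ℝ) : propOne m 0 μ = 1 := by
  rw [propOne, mul_zero, airySol_zero_zero]

theorem propOneDeriv_zero (m : ℕ) (μ : ℝ) : propOneDeriv m 0 μ = 0 := by
  rw [propOneDeriv, mul_zero, airySolDeriv_zero_zero, mul_zero]

theorem propTwo_zero (m : ℕ) (μ : ℝ) : propTwo m 0 μ = 0 := by
  rw [propTwo, mul_zero, airySol_one_zero, zero_div, ite_self]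

theorem propTwoDeriv_zero (m : ℕ) (μ : ℝ) : propTwoDeriv m 0 μ = 1 := by
  rw [propTwoDeriv, mul_zero, airySolDeriv_one_zero]

theorem continuous_airySol (m j : ℕ) : Continuous (airySol m j) :=
  continuous_iff_continuousAt.mpr fun z => (hasDerivAt_airySol m j z).continuousAt

theorem continuous_airySolDeriv (m : ℕ) {j : ℕ} (hj : j ≤ 1) : Continuous (airySolDeriv m j) :=
  continuous_iff_continuousAt.mpr fun z => (hasDerivAt_airySolDeriv m hj z).continuousAt

theorem measurable_propOne (m : ℕ) (t : ℝ) : Measurable (propOne m t) :=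
  ((continuous_airySol m 0).comp (continuous_mul_const t)).measurable

theorem measurable_propOneDeriv (m : ℕ) (t : ℝ) : Measurable (propOneDeriv m t) :=
  (continuous_id.mul ((continuous_airySolDeriv m zero_le_one).comp
    (continuous_mul_const t))).measurable

theorem measurable_propTwo (m : ℕ) (t : ℝ) : Measurable (propTwo m t) :=
  Measurable.ite (measurableSet_singleton 0) measurable_const
    (((continuous_airySol m 1).comp (continuous_mul_const t)).measurable.div measurable_id)

theorem measurable_propTwoDeriv (m : ℕ) (t : ℝ) : Measurable (propTwoDeriv m t) :=
  ((continuous_airySolDeriv m le_rfl).comp (continuous_mul_const t)).measurable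

theorem exists_propOne_bound (m : ℕ) : ∃ C : ℝ, 0 < C ∧ ∀ t μ : ℝ, 0 ≤ t → 0 ≤ μ →
    |propOne m t μ| * (1 + μ * t) ^ ((m : ℝ) / 4) ≤ C ∧
    |propOneDeriv m t μ| ≤ C * (μ * (1 + μ * t) ^ ((m : ℝ) / 4)) := by
  obtain ⟨C, hC, h⟩ := exists_wkb_bound (hasDerivAt_airySol m 0)
    (hasDerivAt_airySolDeriv m zero_le_one)
  refine ⟨C, hC, fun t μ ht hμ => ⟨(h (μ * t) (by positivity)).1, ?_⟩⟩
  rw [propOneDeriv, abs_mul, abs_of_nonneg hμ, mul_left_comm]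
  exact mul_le_mul_of_nonneg_left (h (μ * t) (by positivity)).2 hμ

/-- The factor `t` on the right comes from `w₂(z) = O(z)` at the origin; it keeps the bound
uniform as `μ → 0`. -/
theorem exists_propTwo_bound (m : ℕ) : ∃ C : ℝ, 0 < C ∧ ∀ t μ : ℝ, 0 ≤ t → 0 ≤ μ →
    |propTwo m t μ| * (1 + μ * t) ^ (1 + (m : ℝ) / 4) ≤ C * t ∧
    |propTwoDeriv m t μ| ≤ C * (1 + μ * t) ^ ((m : ℝ) / 4) := by
  obtain ⟨C, hC, h⟩ := exists_wkb_bound (hasDerivAt_airySol m 1)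
    (hasDerivAt_airySolDeriv m le_rfl)
  set κ : ℝ := (m : ℝ) / 4 with hκ
  have hκ0 : 0 ≤ κ := by positivity
  have h2κ : 1 ≤ (2 : ℝ) ^ κ := Real.one_le_rpow (by norm_num) hκ0
  have key : ∀ z : ℝ, 0 ≤ z →
      |airySol m 1 z| * (1 + z) ^ (1 + κ) ≤ 2 * C * 2 ^ κ * 2 ^ κ * z := by
    intro z hz
    rcases le_total z 1 with hz1 | hz1
    · have h1 : |airySol m 1 z| ≤ C * 2 ^ κ * z := by
        have h2 := (convex_Icc (0 : ℝ) 1).norm_image_sub_le_of_norm_hasDerivWithin_le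
          (f := airySol m 1) (f' := airySolDeriv m 1) (C := C * 2 ^ κ)
          (fun x _ => (hasDerivAt_airySol m 1 x).hasDerivWithinAt)
          (fun x hx => (h x hx.1).2.trans (by
            have := hx.1
            have := hx.2
            gcongr
            linarith))
          (left_mem_Icc.mpr zero_le_one) ⟨hz, hz1⟩
        simpa [airySol_one_zero, abs_of_nonneg hz] using h2
      calc |airySol m 1 z| * (1 + z) ^ (1 + κ) ≤ (C * 2 ^ κ * z) * 2 ^ (1 + κ) := by
            gcongr; linarith
        _ = 2 * C * 2 ^ κ * 2 ^ κ * z := by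
            rw [Real.rpow_add (by norm_num), Real.rpow_one]; ring
    · have h1 := (h z hz).1
      calc |airySol m 1 z| * (1 + z) ^ (1 + κ)
          = (|airySol m 1 z| * (1 + z) ^ κ) * (1 + z) := by
            rw [Real.rpow_add (by linarith), Real.rpow_one]; ring
        _ ≤ C * (2 * z) := by gcongr; linarith
        _ = 2 * C * 1 * 1 * z := by ring
        _ ≤ 2 * C * 2 ^ κ * 2 ^ κ * z := by gcongr
  refine ⟨2 * C * 2 ^ κ * 2 ^ κ + 1, by positivity, fun t μ ht hμ => ⟨?_, ?_⟩⟩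
  · rcases hμ.eq_or_lt with rfl | hμ
    · have : 0 ≤ 2 * C * 2 ^ κ * 2 ^ κ * t := by positivity
      simp [propTwo, abs_of_nonneg ht]
      linarith
    · have h1 := key (μ * t) (by positivity)
      rw [propTwo, if_neg hμ.ne', abs_div, abs_of_pos hμ, div_mul_eq_mul_div, div_le_iff₀ hμ]
      have : 0 ≤ t * μ := by positivity
      linarith
  · refine (h (μ * t) (by positivity)).2.trans ?_
    gcongr
    have : C * 1 * 1 ≤ C * 2 ^ κ * 2 ^ κ := by gcongr
    linarith

/-! ### The symbols of the propagators -/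

section Symbol

variable {n : ℕ}

/-- The frequency `(2π|ξ|)^(2/(m+2))`, for which `-Δ` has the symbol `tricomiFreq m ξ ^ (m + 2)`. -/
noncomputable def tricomiFreq (m : ℕ) (ξ : EuclideanSpace ℝ (Fin n)) : ℝ :=
  (2 * Real.pi * ‖ξ‖) ^ (2 / ((m : ℝ) + 2))

theorem tricomiFreq_nonneg (m : ℕ) (ξ : EuclideanSpace ℝ (Fin n)) : 0 ≤ tricomiFreq m ξ := by
  unfold tricomiFreq; positivity

theorem measurable_tricomiFreq (m : ℕ) :
    Measurable (tricomiFreq m : EuclideanSpace ℝ (Fin n) → ℝ) := by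
  unfold tricomiFreq; fun_prop

theorem tricomiFreq_pow (m : ℕ) (ξ : EuclideanSpace ℝ (Fin n)) :
    tricomiFreq m ξ ^ (m + 2) = (2 * Real.pi * ‖ξ‖) ^ 2 := by
  rw [tricomiFreq, ← Real.rpow_natCast, ← Real.rpow_mul (by positivity), ← Real.rpow_natCast]
  congr 1
  push_cast
  field_simp

theorem bracket_le_one_add_tricomiFreq (m : ℕ) (ξ : EuclideanSpace ℝ (Fin n)) :
    bracket (2 / ((m : ℝ) + 2)) ξ ≤ 1 + tricomiFreq m ξ := by
  have hν : 2 / ((m : ℝ) + 2) ≤ 1 := by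
    rw [div_le_one (by positivity)]; linarith [(Nat.cast_nonneg m : (0 : ℝ) ≤ m)]
  have hν0 : 0 ≤ 2 / ((m : ℝ) + 2) := by positivity
  set ν : ℝ := 2 / ((m : ℝ) + 2) with hνdef
  calc bracket ν ξ ≤ 1 ^ (ν / 2) + (‖ξ‖ ^ 2) ^ (ν / 2) :=
        Real.rpow_add_le_add_rpow zero_le_one (by positivity) (by positivity) (by linarith)
    _ = 1 + ‖ξ‖ ^ ν := by
        rw [Real.one_rpow, ← Real.rpow_natCast, ← Real.rpow_mul (norm_nonneg _)]
        congr 2; push_cast; ring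
    _ ≤ 1 + tricomiFreq m ξ := by
        rw [tricomiFreq]
        gcongr
        exact le_mul_of_one_le_left (norm_nonneg _) (by linarith [Real.two_le_pi])

theorem one_add_tricomiFreq_le (m : ℕ) (ξ : EuclideanSpace ℝ (Fin n)) :
    1 + tricomiFreq m ξ ≤ (1 + 2 * Real.pi) * bracket (2 / ((m : ℝ) + 2)) ξ := by
  have hν : 2 / ((m : ℝ) + 2) ≤ 1 := by
    rw [div_le_one (by positivity)]; linarith [(Nat.cast_nonneg m : (0 : ℝ) ≤ m)]
  have hν0 : 0 ≤ 2 / ((m : ℝ) + 2) := by positivity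
  rw [tricomiFreq]
  set ν : ℝ := 2 / ((m : ℝ) + 2) with hνdef
  have h1 : 1 ≤ bracket ν ξ := Real.one_le_rpow (by simp) (by positivity)
  have h2 : ‖ξ‖ ^ ν ≤ bracket ν ξ := by
    calc ‖ξ‖ ^ ν = (‖ξ‖ ^ 2) ^ (ν / 2) := by
          rw [← Real.rpow_natCast, ← Real.rpow_mul (norm_nonneg _)]
          congr 1; push_cast; ring
      _ ≤ bracket ν ξ := by
          unfold bracket; gcongr; linarith
  have h3 : (2 * Real.pi) ^ ν ≤ 2 * Real.pi :=
    Real.rpow_le_self_of_one_le (by linarith [Real.two_le_pi]) hν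
  rw [Real.mul_rpow (by positivity) (norm_nonneg _), add_mul, one_mul]
  gcongr

theorem bracket_le_bracket {r r' : ℝ} (h : r ≤ r') (ξ : EuclideanSpace ℝ (Fin n)) :
    bracket r ξ ≤ bracket r' ξ :=
  Real.rpow_le_rpow_of_exponent_le (by simp) (by linarith)

theorem abs_bracket_mul_le_of_le {r r' : ℝ} (h : r ≤ r') {ξ : EuclideanSpace ℝ (Fin n)} {a B : ℝ}
    (ha : |bracket r' ξ * a| ≤ B) : |bracket r ξ * a| ≤ B := by
  refine le_trans ?_ ha
  rw [abs_mul, abs_mul, abs_of_pos (bracket_pos r ξ), abs_of_pos (bracket_pos r' ξ)]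
  exact mul_le_mul_of_nonneg_right (bracket_le_bracket h ξ) (abs_nonneg a)

/-- Scaling: at time `t`, the weight `t (1 + |ξ|²)^(ν/2)` with `ν = 2 / (m + 2)` is controlled by
`1 + μ t` for bounded `t`, where `μ` is the frequency. -/
theorem rpow_mul_bracket_le (m : ℕ) {t α : ℝ} (ht : 0 ≤ t) (hα : 0 ≤ α)
    (ξ : EuclideanSpace ℝ (Fin n)) :
    t ^ α * bracket (2 / ((m : ℝ) + 2) * α) ξ ≤ (1 + t) ^ α * (1 + tricomiFreq m ξ * t) ^ α := by
  have hμ := tricomiFreq_nonneg m ξ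
  have hb := bracket_le_one_add_tricomiFreq m ξ
  have hb0 := bracket_pos (2 / ((m : ℝ) + 2)) ξ
  rw [bracket_mul, ← Real.mul_rpow ht hb0.le, ← Real.mul_rpow (by positivity) (by positivity)]
  apply Real.rpow_le_rpow (by positivity) _ hα
  calc t * bracket (2 / ((m : ℝ) + 2)) ξ ≤ t * (1 + tricomiFreq m ξ) := by gcongr
    _ ≤ (1 + t) * (1 + tricomiFreq m ξ * t) := by
      have : 0 ≤ t * (tricomiFreq m ξ * t) := by positivity
      linarith

/-- The decay of `propOne` gains regularity, at the cost of a singular factor in `t`. -/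
theorem exists_bracket_mul_propOne_bound (m : ℕ) : ∃ C : ℝ, 0 < C ∧
    ∀ t : ℝ, 0 ≤ t → ∀ ξ : EuclideanSpace ℝ (Fin n),
      |propOne m t (tricomiFreq m ξ)| ≤ C ∧
      t ^ ((m : ℝ) / 4) * |bracket (2 / ((m : ℝ) + 2) * ((m : ℝ) / 4)) ξ *
        propOne m t (tricomiFreq m ξ)| ≤ C * (1 + t) ^ ((m : ℝ) / 4) := by
  obtain ⟨C, hC, h⟩ := exists_propOne_bound m
  refine ⟨C, hC, fun t ht ξ => ?_⟩
  have hμ := tricomiFreq_nonneg m ξ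
  have h1 := (h t _ ht hμ).1
  have h2 := rpow_mul_bracket_le m ht (α := (m : ℝ) / 4) (by positivity) ξ
  constructor
  · refine le_trans (le_mul_of_one_le_right (abs_nonneg _) ?_) h1
    refine Real.one_le_rpow ?_ (by positivity)
    have : 0 ≤ tricomiFreq m ξ * t := by positivity
    linarith
  · rw [abs_mul, abs_of_pos (bracket_pos _ _), ← mul_assoc]
    calc _ ≤ (1 + t) ^ ((m : ℝ) / 4) * (1 + tricomiFreq m ξ * t) ^ ((m : ℝ) / 4) *
          |propOne m t (tricomiFreq m ξ)| := by gcongr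
      _ = (|propOne m t (tricomiFreq m ξ)| * (1 + tricomiFreq m ξ * t) ^ ((m : ℝ) / 4)) *
          (1 + t) ^ ((m : ℝ) / 4) := by ring
      _ ≤ _ := by gcongr

/-- The decay of `propTwo` gains `2 / (m + 2)` derivatives uniformly on bounded time intervals, and
more at the cost of a singular factor in `t`. -/
theorem exists_bracket_mul_propTwo_bound (m : ℕ) : ∃ C : ℝ, 0 < C ∧
    ∀ t : ℝ, 0 ≤ t → ∀ ξ : EuclideanSpace ℝ (Fin n),
      |bracket (2 / ((m : ℝ) + 2)) ξ * propTwo m t (tricomiFreq m ξ)| ≤ C * (1 + t) ∧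
      t ^ ((m : ℝ) / 4) * |bracket (2 / ((m : ℝ) + 2) * (1 + (m : ℝ) / 4)) ξ *
        propTwo m t (tricomiFreq m ξ)| ≤ C * (1 + t) ^ (1 + (m : ℝ) / 4) := by
  obtain ⟨C, hC, h⟩ := exists_propTwo_bound m
  refine ⟨C, hC, fun t ht ξ => ?_⟩
  rcases ht.eq_or_lt with rfl | ht0
  · simp only [propTwo_zero, mul_zero, abs_zero]
    exact ⟨by positivity, by positivity⟩
  have hμ := tricomiFreq_nonneg m ξ
  have h1 := (h t _ ht hμ).1
  have hone : 1 ≤ 1 + tricomiFreq m ξ * t := by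
    have : 0 ≤ tricomiFreq m ξ * t := by positivity
    linarith
  constructor
  · have h2 := rpow_mul_bracket_le m ht (α := 1) zero_le_one ξ
    simp only [Real.rpow_one, mul_one] at h2
    rw [abs_mul, abs_of_pos (bracket_pos _ _)]
    -- The factor `t` that the scaling estimate needs is the one on the right of `h1`.
    refine le_of_mul_le_mul_left ?_ ht0
    have h3 : 1 + tricomiFreq m ξ * t ≤ (1 + tricomiFreq m ξ * t) ^ (1 + (m : ℝ) / 4) :=
      Real.self_le_rpow_of_one_le hone (by
        have : (0 : ℝ) ≤ (m : ℝ) / 4 := by positivity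
        linarith)
    calc _ = t * bracket (2 / ((m : ℝ) + 2)) ξ * |propTwo m t (tricomiFreq m ξ)| := by ring
      _ ≤ (1 + t) * (1 + tricomiFreq m ξ * t) ^ (1 + (m : ℝ) / 4) *
          |propTwo m t (tricomiFreq m ξ)| := by
        exact mul_le_mul_of_nonneg_right (h2.trans (by gcongr)) (abs_nonneg _)
      _ = (|propTwo m t (tricomiFreq m ξ)| * (1 + tricomiFreq m ξ * t) ^ (1 + (m : ℝ) / 4)) *
          (1 + t) := by ring
      _ ≤ (C * t) * (1 + t) := by gcongr
      _ = _ := by ring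
  · have h2 := rpow_mul_bracket_le m ht (α := 1 + (m : ℝ) / 4) (by positivity) ξ
    rw [Real.rpow_add ht0, Real.rpow_one] at h2
    rw [abs_mul, abs_of_pos (bracket_pos _ _)]
    refine le_of_mul_le_mul_left ?_ ht0
    calc _ = t * t ^ ((m : ℝ) / 4) * bracket (2 / ((m : ℝ) + 2) * (1 + (m : ℝ) / 4)) ξ *
          |propTwo m t (tricomiFreq m ξ)| := by ring
      _ ≤ (1 + t) ^ (1 + (m : ℝ) / 4) * (1 + tricomiFreq m ξ * t) ^ (1 + (m : ℝ) / 4) *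
          |propTwo m t (tricomiFreq m ξ)| := by gcongr
      _ = (|propTwo m t (tricomiFreq m ξ)| * (1 + tricomiFreq m ξ * t) ^ (1 + (m : ℝ) / 4)) *
          (1 + t) ^ (1 + (m : ℝ) / 4) := by ring
      _ ≤ (C * t) * (1 + t) ^ (1 + (m : ℝ) / 4) := by gcongr
      _ = _ := by ring

theorem one_add_mul_rpow_le (m : ℕ) {t α : ℝ} (ht : 0 ≤ t) (hα : 0 ≤ α)
    (ξ : EuclideanSpace ℝ (Fin n)) :
    (1 + tricomiFreq m ξ * t) ^ α ≤ (1 + tricomiFreq m ξ) ^ α * (1 + t) ^ α := by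
  have hμ := tricomiFreq_nonneg m ξ
  rw [← Real.mul_rpow (by positivity) (by positivity)]
  apply Real.rpow_le_rpow (by positivity) _ hα
  linarith

theorem bracket_neg_mul_rpow_le (m : ℕ) {α : ℝ} (hα : 0 ≤ α) (ξ : EuclideanSpace ℝ (Fin n)) :
    bracket (-(2 / ((m : ℝ) + 2) * α)) ξ * (1 + tricomiFreq m ξ) ^ α ≤ (1 + 2 * Real.pi) ^ α := by
  have hμ := tricomiFreq_nonneg m ξ
  have hb := bracket_pos (2 / ((m : ℝ) + 2)) ξ
  calc _ ≤ bracket (-(2 / ((m : ℝ) + 2) * α)) ξ *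
        ((1 + 2 * Real.pi) * bracket (2 / ((m : ℝ) + 2)) ξ) ^ α := by
        gcongr
        · exact (bracket_pos _ _).le
        · exact one_add_tricomiFreq_le m ξ
    _ = (1 + 2 * Real.pi) ^ α *
        (bracket (-(2 / ((m : ℝ) + 2) * α)) ξ * bracket (2 / ((m : ℝ) + 2) * α) ξ) := by
        rw [Real.mul_rpow (by positivity) hb.le, ← bracket_mul]; ring
    _ = _ := by rw [← bracket_add, neg_add_cancel, bracket_zero, mul_one]

theorem exists_bracket_mul_propOneDeriv_bound (m : ℕ) : ∃ C : ℝ, 0 < C ∧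
    ∀ t : ℝ, 0 ≤ t → ∀ ξ : EuclideanSpace ℝ (Fin n),
      |bracket (-(2 / ((m : ℝ) + 2) * (1 + (m : ℝ) / 4))) ξ *
        propOneDeriv m t (tricomiFreq m ξ)| ≤ C * (1 + t) ^ ((m : ℝ) / 4) := by
  obtain ⟨C, hC, h⟩ := exists_propOne_bound m
  refine ⟨C * (1 + 2 * Real.pi) ^ (1 + (m : ℝ) / 4), by positivity, fun t ht ξ => ?_⟩
  have hμ := tricomiFreq_nonneg m ξ
  have h1 := (h t _ ht hμ).2
  have h2 := one_add_mul_rpow_le m ht (α := (m : ℝ) / 4) (by positivity) ξ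
  have h3 := bracket_neg_mul_rpow_le m (α := 1 + (m : ℝ) / 4) (by positivity) ξ
  have hb := bracket_pos (-(2 / ((m : ℝ) + 2) * (1 + (m : ℝ) / 4))) ξ
  rw [abs_mul, abs_of_pos hb]
  set b := bracket (-(2 / ((m : ℝ) + 2) * (1 + (m : ℝ) / 4))) ξ
  calc b * |propOneDeriv m t (tricomiFreq m ξ)|
      ≤ b * (C * (tricomiFreq m ξ * (1 + tricomiFreq m ξ * t) ^ ((m : ℝ) / 4))) := by gcongr
    _ ≤ b * (C * ((1 + tricomiFreq m ξ) *
          ((1 + tricomiFreq m ξ) ^ ((m : ℝ) / 4) * (1 + t) ^ ((m : ℝ) / 4)))) := by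
        gcongr
        linarith
    _ = C * (b * (1 + tricomiFreq m ξ) ^ (1 + (m : ℝ) / 4)) * (1 + t) ^ ((m : ℝ) / 4) := by
        rw [Real.rpow_add (by positivity), Real.rpow_one]; ring
    _ ≤ _ := by gcongr

theorem exists_bracket_mul_propTwoDeriv_bound (m : ℕ) : ∃ C : ℝ, 0 < C ∧
    ∀ t : ℝ, 0 ≤ t → ∀ ξ : EuclideanSpace ℝ (Fin n),
      |bracket (-(2 / ((m : ℝ) + 2) * ((m : ℝ) / 4))) ξ *
        propTwoDeriv m t (tricomiFreq m ξ)| ≤ C * (1 + t) ^ ((m : ℝ) / 4) := by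
  obtain ⟨C, hC, h⟩ := exists_propTwo_bound m
  refine ⟨C * (1 + 2 * Real.pi) ^ ((m : ℝ) / 4), by positivity, fun t ht ξ => ?_⟩
  have hμ := tricomiFreq_nonneg m ξ
  have h1 := (h t _ ht hμ).2
  have h2 := one_add_mul_rpow_le m ht (α := (m : ℝ) / 4) (by positivity) ξ
  have h3 := bracket_neg_mul_rpow_le m (α := (m : ℝ) / 4) (by positivity) ξ
  have hb := bracket_pos (-(2 / ((m : ℝ) + 2) * ((m : ℝ) / 4))) ξ
  rw [abs_mul, abs_of_pos hb]
  set b := bracket (-(2 / ((m : ℝ) + 2) * ((m : ℝ) / 4))) ξ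
  calc b * |propTwoDeriv m t (tricomiFreq m ξ)|
      ≤ b * (C * (1 + tricomiFreq m ξ * t) ^ ((m : ℝ) / 4)) := by gcongr
    _ ≤ b * (C * ((1 + tricomiFreq m ξ) ^ ((m : ℝ) / 4) * (1 + t) ^ ((m : ℝ) / 4))) := by gcongr
    _ = C * (b * (1 + tricomiFreq m ξ) ^ ((m : ℝ) / 4)) * (1 + t) ^ ((m : ℝ) / 4) := by ring
    _ ≤ _ := by gcongr

/-- Multiplication of a symbol by that of `t ^ m Δ` costs two derivatives. -/
theorem abs_bracket_mul_freq_sq_le {r a B t : ℝ} (m : ℕ) (ht : 0 ≤ t)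
    {ξ : EuclideanSpace ℝ (Fin n)} (ha : |bracket (r + 2) ξ * a| ≤ B) :
    |bracket r ξ * (-((2 * Real.pi * ‖ξ‖) ^ 2 * t ^ m * a))| ≤ (2 * Real.pi) ^ 2 * t ^ m * B := by
  have hb := bracket_pos r ξ
  have h2 : ‖ξ‖ ^ 2 ≤ bracket 2 ξ := by simp [bracket]
  rw [bracket_add, abs_mul, abs_of_pos (mul_pos hb (bracket_pos 2 ξ))] at ha
  rw [abs_mul, abs_neg, abs_mul, abs_of_pos hb, abs_of_nonneg (a := _ * t ^ m) (by positivity)]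
  calc _ = (2 * Real.pi) ^ 2 * t ^ m * (bracket r ξ * ‖ξ‖ ^ 2 * |a|) := by ring
    _ ≤ (2 * Real.pi) ^ 2 * t ^ m * (bracket r ξ * bracket 2 ξ * |a|) := by gcongr
    _ ≤ _ := by gcongr

end Symbol

/-! ### The Cauchy problem -/

section Cauchy

open SobolevSpace

variable {n : ℕ}

theorem abs_bracket_mul_le_of_nonpos {r : ℝ} (hr : r ≤ 0) {ξ : EuclideanSpace ℝ (Fin n)}
    {a B : ℝ} (ha : |a| ≤ B) : |bracket r ξ * a| ≤ B :=
  abs_bracket_mul_le_of_le hr (by rwa [bracket_zero, one_mul])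

theorem two_div_mul_le_one (m : ℕ) : 2 / ((m : ℝ) + 2) * (1 + (m : ℝ) / 4) ≤ 1 := by
  rw [div_mul_eq_mul_div, div_le_one (by positivity)]
  linarith [(Nat.cast_nonneg m : (0 : ℝ) ≤ m)]

/-- The propagators solve the Cauchy problem. In `H^(s - 2)` the curve is twice differentiable. -/
theorem isTricomiSolution_fourierMul (m : ℕ) {s ν : ℝ} (hν : 2 / ((m : ℝ) + 2) = ν)
    (φ₁ : SobolevSpace n s) (φ₂ : SobolevSpace n (s - ν)) :
    IsTricomiSolution m φ₁.toDistribution φ₂.toDistribution fun t =>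
      toDistribution (fourierMul (s - 2) (fun ξ => propOne m t (tricomiFreq m ξ)) φ₁ +
        fourierMul (s - 2) (fun ξ => propTwo m t (tricomiFreq m ξ)) φ₂) := by
  obtain ⟨C₁, hC₁, h₁⟩ := exists_bracket_mul_propOne_bound (n := n) m
  obtain ⟨C₂, hC₂, h₂⟩ := exists_bracket_mul_propTwo_bound (n := n) m
  obtain ⟨C₃, hC₃, h₃⟩ := exists_bracket_mul_propOneDeriv_bound (n := n) m
  obtain ⟨C₄, hC₄, h₄⟩ := exists_bracket_mul_propTwoDeriv_bound (n := n) m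
  have hν1 := two_div_mul_le_one m
  have hν0 : 0 ≤ 2 / ((m : ℝ) + 2) := by positivity
  have hκ0 : 0 ≤ (m : ℝ) / 4 := by positivity
  have hνκ0 : 0 ≤ 2 / ((m : ℝ) + 2) * ((m : ℝ) / 4) := by positivity
  have hcont : Continuous fun t : ℝ => (1 + t) ^ ((m : ℝ) / 4) :=
    (continuous_const.add continuous_id).rpow_const fun _ => Or.inr hκ0
  have hμm := measurable_tricomiFreq (n := n) m
  simp only [hν] at h₁ h₂ h₃ h₄ hν1 hν0 hνκ0
  set κ : ℝ := (m : ℝ) / 4 with hκ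
  have hνκ : ν * (1 + κ) = ν + ν * κ := by ring
  -- Bounds for the symbols, and for their first and second derivatives in `t`.
  have a1 : ∀ t ∈ Ici (0 : ℝ), ∀ ξ : EuclideanSpace ℝ (Fin n),
      |bracket (s - 2 - s) ξ * propOne m t (tricomiFreq m ξ)| ≤ C₁ := fun t ht ξ =>
    abs_bracket_mul_le_of_nonpos (by linarith) (h₁ t ht ξ).1
  have a2 : ∀ t ∈ Ici (0 : ℝ), ∀ ξ : EuclideanSpace ℝ (Fin n),
      |bracket (s - 2 - (s - ν)) ξ * propTwo m t (tricomiFreq m ξ)| ≤ C₂ * (1 + t) :=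
    fun t ht ξ => abs_bracket_mul_le_of_le (by linarith) (h₂ t ht ξ).1
  have b1 : ∀ t ∈ Ici (0 : ℝ), ∀ ξ : EuclideanSpace ℝ (Fin n),
      |bracket (s - 2 - s) ξ * propOneDeriv m t (tricomiFreq m ξ)| ≤ C₃ * (1 + t) ^ κ :=
    fun t ht ξ => abs_bracket_mul_le_of_le (by linarith) (h₃ t ht ξ)
  have b2 : ∀ t ∈ Ici (0 : ℝ), ∀ ξ : EuclideanSpace ℝ (Fin n),
      |bracket (s - 2 - (s - ν)) ξ * propTwoDeriv m t (tricomiFreq m ξ)| ≤ C₄ * (1 + t) ^ κ :=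
    fun t ht ξ => abs_bracket_mul_le_of_le (by linarith) (h₄ t ht ξ)
  have c1 : ∀ t ∈ Ici (0 : ℝ), ∀ ξ : EuclideanSpace ℝ (Fin n),
      |bracket (s - 2 - s) ξ *
        (-((2 * Real.pi * ‖ξ‖) ^ 2 * t ^ m * propOne m t (tricomiFreq m ξ)))| ≤
          (2 * Real.pi) ^ 2 * t ^ m * C₁ := fun t ht ξ =>
    abs_bracket_mul_freq_sq_le m ht
      (abs_bracket_mul_le_of_nonpos (by linarith) (h₁ t ht ξ).1)
  have c2 : ∀ t ∈ Ici (0 : ℝ), ∀ ξ : EuclideanSpace ℝ (Fin n),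
      |bracket (s - 2 - (s - ν)) ξ *
        (-((2 * Real.pi * ‖ξ‖) ^ 2 * t ^ m * propTwo m t (tricomiFreq m ξ)))| ≤
          (2 * Real.pi) ^ 2 * t ^ m * (C₂ * (1 + t)) := fun t ht ξ =>
    abs_bracket_mul_freq_sq_le m ht (abs_bracket_mul_le_of_le (by linarith) (h₂ t ht ξ).1)
  have ma1 : ∀ t, Measurable fun ξ : EuclideanSpace ℝ (Fin n) =>
      propOne m t (tricomiFreq m ξ) := fun t => (measurable_propOne m t).comp hμm
  have ma2 : ∀ t, Measurable fun ξ : EuclideanSpace ℝ (Fin n) =>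
      propTwo m t (tricomiFreq m ξ) := fun t => (measurable_propTwo m t).comp hμm
  have mb1 : ∀ t, Measurable fun ξ : EuclideanSpace ℝ (Fin n) =>
      propOneDeriv m t (tricomiFreq m ξ) := fun t => (measurable_propOneDeriv m t).comp hμm
  have mb2 : ∀ t, Measurable fun ξ : EuclideanSpace ℝ (Fin n) =>
      propTwoDeriv m t (tricomiFreq m ξ) := fun t => (measurable_propTwoDeriv m t).comp hμm
  refine ⟨fun t => toDistribution
      (fourierMul (s - 2) (fun ξ => propOneDeriv m t (tricomiFreq m ξ)) φ₁ +
        fourierMul (s - 2) (fun ξ => propTwoDeriv m t (tricomiFreq m ξ)) φ₂), ?_, ?_, ?_⟩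
  · simp only [propOne_zero, propTwo_zero, map_add]
    rw [toDistribution_fourierMul_one (by linarith), toDistribution_fourierMul_zero, add_zero]
  · simp only [propOneDeriv_zero, propTwoDeriv_zero, map_add]
    rw [toDistribution_fourierMul_one (by linarith), toDistribution_fourierMul_zero, zero_add]
  intro ψ t ht
  have ht' : t ∈ Ici (0 : ℝ) := ht
  simp only [map_add]
  constructor
  · exact (hasDerivWithinAt_fourierMul_apply (convex_Ici 0) (fun t _ => ma1 t)
      (fun t _ => mb1 t) (B' := fun t => C₃ * (1 + t) ^ κ)
      (continuous_const.mul hcont).continuousOn a1 b1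
      (fun ξ t _ => (hasDerivAt_propOne m t _).hasDerivWithinAt) φ₁ ψ ht').add
      (hasDerivWithinAt_fourierMul_apply (convex_Ici 0) (fun t _ => ma2 t)
      (fun t _ => mb2 t) (B' := fun t => C₄ * (1 + t) ^ κ)
      (continuous_const.mul hcont).continuousOn a2 b2
      (fun ξ t _ => (hasDerivAt_propTwo m t _).hasDerivWithinAt) φ₂ ψ ht')
  · have hlap : (t : ℂ) ^ m * (Δ (toDistribution
        (fourierMul (s - 2) (fun ξ => propOne m t (tricomiFreq m ξ)) φ₁) + toDistribution
        (fourierMul (s - 2) (fun ξ => propTwo m t (tricomiFreq m ξ)) φ₂))) ψ =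
      toDistribution (fourierMul (s - 2) (fun ξ =>
        -((2 * Real.pi * ‖ξ‖) ^ 2 * t ^ m * propOne m t (tricomiFreq m ξ))) φ₁) ψ +
      toDistribution (fourierMul (s - 2) (fun ξ =>
        -((2 * Real.pi * ‖ξ‖) ^ 2 * t ^ m * propTwo m t (tricomiFreq m ξ))) φ₂) ψ := by
      rw [laplacian_toDistribution_fourierMul (ma1 t) (a1 t ht') (t ^ m) (c1 t ht'),
        laplacian_toDistribution_fourierMul (ma2 t) (a2 t ht') (t ^ m) (c2 t ht'), ← mul_add,
        Complex.ofReal_pow]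
      simp only [TemperedDistribution.laplacian_apply_apply]
      rfl
    rw [hlap]
    refine (hasDerivWithinAt_fourierMul_apply (convex_Ici 0)
      (p' := fun t ξ => -((2 * Real.pi * ‖ξ‖) ^ 2 * t ^ m * propOne m t (tricomiFreq m ξ)))
      (fun t _ => mb1 t) (fun t _ => (((by fun_prop : Measurable fun ξ :
        EuclideanSpace ℝ (Fin n) => (2 * Real.pi * ‖ξ‖) ^ 2 * t ^ m)).mul (ma1 t)).neg)
      (B' := fun t => (2 * Real.pi) ^ 2 * t ^ m * C₁)
      (by fun_prop) b1 c1 (fun ξ t _ => ?_) φ₁ ψ ht').add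
      (hasDerivWithinAt_fourierMul_apply (convex_Ici 0)
      (p' := fun t ξ => -((2 * Real.pi * ‖ξ‖) ^ 2 * t ^ m * propTwo m t (tricomiFreq m ξ)))
      (fun t _ => mb2 t) (fun t _ => (((by fun_prop : Measurable fun ξ :
        EuclideanSpace ℝ (Fin n) => (2 * Real.pi * ‖ξ‖) ^ 2 * t ^ m)).mul (ma2 t)).neg)
      (B' := fun t => (2 * Real.pi) ^ 2 * t ^ m * (C₂ * (1 + t)))
      (by fun_prop) b2 c2 (fun ξ t _ => ?_) φ₂ ψ ht')
    · have h := (hasDerivAt_propOneDeriv m t (tricomiFreq m ξ)).hasDerivWithinAt (s := Ici 0)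
      rwa [tricomiFreq_pow] at h
    · have h := (hasDerivAt_propTwoDeriv m t (tricomiFreq m ξ)).hasDerivWithinAt (s := Ici 0)
      rwa [tricomiFreq_pow] at h

end Cauchy

open SobolevSpace in
theorem proposition3p3 (n m : ℕ) (hn : 2 ≤ n) (s T : ℝ) (hT : 0 < T) :
    ∃ C : ℝ, 0 < C ∧
      ∀ (φ₁ : SobolevSpace n s) (φ₂ : SobolevSpace n (s - 2 / ((m : ℝ) + 2))),
      ∃ u : ℝ → 𝓢'(EuclideanSpace ℝ (Fin n), ℂ),
        IsTricomiSolution m φ₁.toDistribution φ₂.toDistribution u ∧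
        -- `u` as a curve in each of the three Sobolev spaces
        ∃ (U₀ : ℝ → SobolevSpace n s)
          (U₁ : ℝ → SobolevSpace n (s + (m : ℝ) / (2 * ((m : ℝ) + 2))))
          (U₂ : ℝ → SobolevSpace n (s - ((m : ℝ) + 4) / (2 * ((m : ℝ) + 2)))),
          (∀ t ∈ Icc 0 T, (U₀ t).toDistribution = u t) ∧
          (∀ t ∈ Ioc 0 T, (U₁ t).toDistribution = u t) ∧
          (∀ t ∈ Icc 0 T, (U₂ t).toDistribution = u t) ∧
          ContinuousOn U₀ (Icc 0 T) ∧
          ContinuousOn U₁ (Ioc 0 T) ∧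
          ContDiffOn ℝ 1 U₂ (Icc 0 T) ∧
          ∀ t ∈ Ioc 0 T,
            ‖U₀ t‖ + t ^ ((m : ℝ) / 4) * ‖U₁ t‖ + ‖derivWithin U₂ (Icc 0 T) t‖
              ≤ C * (‖φ₁‖ + ‖φ₂‖) := by
  obtain ⟨C₁, hC₁, h₁⟩ := exists_bracket_mul_propOne_bound (n := n) m
  obtain ⟨C₂, hC₂, h₂⟩ := exists_bracket_mul_propTwo_bound (n := n) m
  obtain ⟨C₃, hC₃, h₃⟩ := exists_bracket_mul_propOneDeriv_bound (n := n) m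
  obtain ⟨C₄, hC₄, h₄⟩ := exists_bracket_mul_propTwoDeriv_bound (n := n) m
  have hν1 := two_div_mul_le_one m
  have hν0 : 0 ≤ 2 / ((m : ℝ) + 2) := by positivity
  have hκ0 : 0 ≤ (m : ℝ) / 4 := by positivity
  have hνκ0 : 0 ≤ 2 / ((m : ℝ) + 2) * ((m : ℝ) / 4) := by positivity
  have hμm := measurable_tricomiFreq (n := n) m
  have hr₁ : s + (m : ℝ) / (2 * ((m : ℝ) + 2)) = s + 2 / ((m : ℝ) + 2) * ((m : ℝ) / 4) := by
    field_simp; ring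
  have hr₂ : s - ((m : ℝ) + 4) / (2 * ((m : ℝ) + 2)) =
      s - 2 / ((m : ℝ) + 2) * (1 + (m : ℝ) / 4) := by
    field_simp; ring
  rw [hr₁, hr₂]
  have hcontκ : Continuous fun t : ℝ => (1 + t) ^ ((m : ℝ) / 4) :=
    (continuous_const.add continuous_id).rpow_const fun _ => Or.inr hκ0
  have hcontκ1 : Continuous fun t : ℝ => (1 + t) ^ (1 + (m : ℝ) / 4) :=
    (continuous_const.add continuous_id).rpow_const fun _ => Or.inr (by positivity)
  set ν : ℝ := 2 / ((m : ℝ) + 2) with hν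
  set κ : ℝ := (m : ℝ) / 4 with hκ
  set r₁ : ℝ := s + ν * κ with hr₁'
  set r₂ : ℝ := s - ν * (1 + κ) with hr₂'
  have hνκ : ν * (1 + κ) = ν + ν * κ := by ring
  have hcontt : ContinuousOn (fun t : ℝ => t ^ κ) (Ioc 0 T) :=
    continuousOn_id.rpow_const fun _ _ => Or.inr hκ0
  have htne : ∀ t ∈ Ioc 0 T, t ^ κ ≠ 0 := fun t ht => (Real.rpow_pos_of_pos ht.1 κ).ne'
  have ma1 : ∀ t, Measurable fun ξ : EuclideanSpace ℝ (Fin n) =>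
      propOne m t (tricomiFreq m ξ) := fun t => (measurable_propOne m t).comp hμm
  have ma2 : ∀ t, Measurable fun ξ : EuclideanSpace ℝ (Fin n) =>
      propTwo m t (tricomiFreq m ξ) := fun t => (measurable_propTwo m t).comp hμm
  have mb1 : ∀ t, Measurable fun ξ : EuclideanSpace ℝ (Fin n) =>
      propOneDeriv m t (tricomiFreq m ξ) := fun t => (measurable_propOneDeriv m t).comp hμm
  have mb2 : ∀ t, Measurable fun ξ : EuclideanSpace ℝ (Fin n) =>
      propTwoDeriv m t (tricomiFreq m ξ) := fun t => (measurable_propTwoDeriv m t).comp hμm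
  have ca1 : ∀ (S : Set ℝ) (ξ : EuclideanSpace ℝ (Fin n)),
      ContinuousOn (fun t => propOne m t (tricomiFreq m ξ)) S := fun S ξ t _ =>
    (hasDerivAt_propOne m t _).continuousAt.continuousWithinAt
  have ca2 : ∀ (S : Set ℝ) (ξ : EuclideanSpace ℝ (Fin n)),
      ContinuousOn (fun t => propTwo m t (tricomiFreq m ξ)) S := fun S ξ t _ =>
    (hasDerivAt_propTwo m t _).continuousAt.continuousWithinAt
  have cb1 : ∀ (S : Set ℝ) (ξ : EuclideanSpace ℝ (Fin n)),
      ContinuousOn (fun t => propOneDeriv m t (tricomiFreq m ξ)) S := fun S ξ t _ =>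
    (hasDerivAt_propOneDeriv m t _).continuousAt.continuousWithinAt
  have cb2 : ∀ (S : Set ℝ) (ξ : EuclideanSpace ℝ (Fin n)),
      ContinuousOn (fun t => propTwoDeriv m t (tricomiFreq m ξ)) S := fun S ξ t _ =>
    (hasDerivAt_propTwoDeriv m t _).continuousAt.continuousWithinAt
  -- For targets of order at most `s`, the symbols are bounded on `[0, T]`.
  have a1 : ∀ r ≤ s, ∀ t : ℝ, 0 ≤ t → ∀ ξ : EuclideanSpace ℝ (Fin n),
      |bracket (r - s) ξ * propOne m t (tricomiFreq m ξ)| ≤ C₁ := fun r hr t ht ξ =>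
    abs_bracket_mul_le_of_nonpos (by linarith) (h₁ t ht ξ).1
  have a2 : ∀ r ≤ s, ∀ t : ℝ, 0 ≤ t → ∀ ξ : EuclideanSpace ℝ (Fin n),
      |bracket (r - (s - ν)) ξ * propTwo m t (tricomiFreq m ξ)| ≤ C₂ * (1 + t) :=
    fun r hr t ht ξ => abs_bracket_mul_le_of_le (by linarith) (h₂ t ht ξ).1
  -- For the target of order `s + ν κ`, the bounds blow up at `t = 0`.
  have d1 : ∀ t ∈ Ioc 0 T, ∀ ξ : EuclideanSpace ℝ (Fin n),
      |bracket (r₁ - s) ξ * propOne m t (tricomiFreq m ξ)| ≤ C₁ * (1 + t) ^ κ / t ^ κ :=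
    fun t ht ξ => by
      rw [le_div_iff₀' (Real.rpow_pos_of_pos ht.1 κ), show r₁ - s = ν * κ by rw [hr₁']; ring]
      exact (h₁ t ht.1.le ξ).2
  have d2 : ∀ t ∈ Ioc 0 T, ∀ ξ : EuclideanSpace ℝ (Fin n),
      |bracket (r₁ - (s - ν)) ξ * propTwo m t (tricomiFreq m ξ)| ≤
        C₂ * (1 + t) ^ (1 + κ) / t ^ κ :=
    fun t ht ξ => by
      rw [le_div_iff₀' (Real.rpow_pos_of_pos ht.1 κ),
        show r₁ - (s - ν) = ν * (1 + κ) by rw [hr₁']; ring]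
      exact (h₂ t ht.1.le ξ).2
  have b1 : ∀ t ∈ Icc 0 T, ∀ ξ : EuclideanSpace ℝ (Fin n),
      |bracket (r₂ - s) ξ * propOneDeriv m t (tricomiFreq m ξ)| ≤ C₃ * (1 + t) ^ κ :=
    fun t ht ξ => abs_bracket_mul_le_of_le (by linarith) (h₃ t ht.1 ξ)
  have b2 : ∀ t ∈ Icc 0 T, ∀ ξ : EuclideanSpace ℝ (Fin n),
      |bracket (r₂ - (s - ν)) ξ * propTwoDeriv m t (tricomiFreq m ξ)| ≤ C₄ * (1 + t) ^ κ :=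
    fun t ht ξ => abs_bracket_mul_le_of_le (by linarith) (h₄ t ht.1 ξ)
  have hr₂s : r₂ ≤ s := by linarith
  refine ⟨(C₁ + C₂ * (1 + T)) + (C₁ * (1 + T) ^ κ + C₂ * (1 + T) ^ (1 + κ)) +
    (C₃ * (1 + T) ^ κ + C₄ * (1 + T) ^ κ), by positivity, fun φ₁ φ₂ => ?_⟩
  set V : ∀ r : ℝ, ℝ → SobolevSpace n r := fun r t =>
    fourierMul r (fun ξ => propOne m t (tricomiFreq m ξ)) φ₁ +
      fourierMul r (fun ξ => propTwo m t (tricomiFreq m ξ)) φ₂ with hV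
  set V' : ℝ → SobolevSpace n r₂ := fun t =>
    fourierMul r₂ (fun ξ => propOneDeriv m t (tricomiFreq m ξ)) φ₁ +
      fourierMul r₂ (fun ξ => propTwoDeriv m t (tricomiFreq m ξ)) φ₂ with hV'
  have hderiv : ∀ t ∈ Icc 0 T, HasDerivWithinAt (V r₂) (V' t) (Icc 0 T) t := fun t ht =>
    (hasDerivWithinAt_fourierMul (convex_Icc 0 T) (fun t _ => ma1 t) (fun t _ => mb1 t)
      (B' := fun t => C₃ * (1 + t) ^ κ) (continuous_const.mul hcontκ).continuousOn
      (fun t ht => a1 r₂ hr₂s t ht.1) b1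
      (fun ξ t _ => (hasDerivAt_propOne m t _).hasDerivWithinAt) φ₁ ht).add
    (hasDerivWithinAt_fourierMul (convex_Icc 0 T) (fun t _ => ma2 t) (fun t _ => mb2 t)
      (B' := fun t => C₄ * (1 + t) ^ κ) (continuous_const.mul hcontκ).continuousOn
      (fun t ht => a2 r₂ hr₂s t ht.1) b2
      (fun ξ t _ => (hasDerivAt_propTwo m t _).hasDerivWithinAt) φ₂ ht)
  have hdw : ∀ t ∈ Icc 0 T, derivWithin (V r₂) (Icc 0 T) t = V' t := fun t ht =>
    (hderiv t ht).derivWithin (uniqueDiffOn_Icc hT t ht)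
  refine ⟨fun t => toDistribution (V (s - 2) t), isTricomiSolution_fourierMul m hν.symm φ₁ φ₂,
    V s, V r₁, V r₂, fun t ht => ?_, fun t ht => ?_, fun t ht => ?_, ?_, ?_, ?_, fun t ht => ?_⟩
  · simp only [hV, map_add]
    rw [toDistribution_fourierMul_congr (ma1 t) (a1 s le_rfl t ht.1)
        (a1 (s - 2) (by linarith) t ht.1),
      toDistribution_fourierMul_congr (ma2 t) (a2 s le_rfl t ht.1)
        (a2 (s - 2) (by linarith) t ht.1)]
  · simp only [hV, map_add]
    rw [toDistribution_fourierMul_congr (ma1 t) (d1 t ht) (a1 (s - 2) (by linarith) t ht.1.le),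
      toDistribution_fourierMul_congr (ma2 t) (d2 t ht) (a2 (s - 2) (by linarith) t ht.1.le)]
  · simp only [hV, map_add]
    rw [toDistribution_fourierMul_congr (ma1 t) (a1 r₂ hr₂s t ht.1)
        (a1 (s - 2) (by linarith) t ht.1),
      toDistribution_fourierMul_congr (ma2 t) (a2 r₂ hr₂s t ht.1)
        (a2 (s - 2) (by linarith) t ht.1)]
  · exact (continuousOn_fourierMul (B := fun _ => C₁) (fun t _ => ma1 t) continuousOn_const
      (fun t ht => a1 s le_rfl t ht.1) (ca1 _) φ₁).add
      (continuousOn_fourierMul (B := fun t => C₂ * (1 + t)) (fun t _ => ma2 t) (by fun_prop)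
      (fun t ht => a2 s le_rfl t ht.1) (ca2 _) φ₂)
  · exact (continuousOn_fourierMul (fun t _ => ma1 t)
      ((continuous_const.mul hcontκ).continuousOn.div hcontt htne) d1 (ca1 _) φ₁).add
      (continuousOn_fourierMul (fun t _ => ma2 t)
      ((continuous_const.mul hcontκ1).continuousOn.div hcontt htne) d2 (ca2 _) φ₂)
  · rw [contDiffOn_one_iff_derivWithin (uniqueDiffOn_Icc hT)]
    refine ⟨fun t ht => (hderiv t ht).differentiableWithinAt, ContinuousOn.congr ?_ hdw⟩
    exact (continuousOn_fourierMul (fun t _ => mb1 t)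
      (continuous_const.mul hcontκ).continuousOn b1 (cb1 _) φ₁).add
      (continuousOn_fourierMul (fun t _ => mb2 t)
      (continuous_const.mul hcontκ).continuousOn b2 (cb2 _) φ₂)
  · have ht0 : 0 < t := ht.1
    have htT : 1 + t ≤ 1 + T := by linarith [ht.2]
    have htc : t ∈ Icc 0 T := ⟨ht.1.le, ht.2⟩
    have hp : (1 + t) ^ κ ≤ (1 + T) ^ κ := by gcongr
    have hp1 : (1 + t) ^ (1 + κ) ≤ (1 + T) ^ (1 + κ) := by gcongr
    have hφ₁ := norm_nonneg φ₁
    have hφ₂ := norm_nonneg φ₂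
    have e0 : ‖V s t‖ ≤ C₁ * ‖φ₁‖ + C₂ * (1 + T) * ‖φ₂‖ := by
      refine (norm_add_le _ _).trans (add_le_add
        (norm_fourierMul_le (ma1 t) (a1 s le_rfl t ht0.le) φ₁)
        ((norm_fourierMul_le (ma2 t) (a2 s le_rfl t ht0.le) φ₂).trans ?_))
      gcongr
    have e1 : t ^ κ * ‖V r₁ t‖ ≤
        C₁ * (1 + T) ^ κ * ‖φ₁‖ + C₂ * (1 + T) ^ (1 + κ) * ‖φ₂‖ := by
      have htκ : 0 < t ^ κ := Real.rpow_pos_of_pos ht0 κ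
      calc t ^ κ * ‖V r₁ t‖ ≤ t ^ κ * (C₁ * (1 + t) ^ κ / t ^ κ * ‖φ₁‖ +
            C₂ * (1 + t) ^ (1 + κ) / t ^ κ * ‖φ₂‖) := by
            gcongr
            exact (norm_add_le _ _).trans (add_le_add (norm_fourierMul_le (ma1 t) (d1 t ht) φ₁)
              (norm_fourierMul_le (ma2 t) (d2 t ht) φ₂))
        _ = C₁ * (1 + t) ^ κ * ‖φ₁‖ + C₂ * (1 + t) ^ (1 + κ) * ‖φ₂‖ := by field_simp
        _ ≤ _ := by gcongr
    have e2 : ‖derivWithin (V r₂) (Icc 0 T) t‖ ≤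
        C₃ * (1 + T) ^ κ * ‖φ₁‖ + C₄ * (1 + T) ^ κ * ‖φ₂‖ := by
      rw [hdw t htc]
      refine ((norm_add_le _ _).trans (add_le_add (norm_fourierMul_le (mb1 t) (b1 t htc) φ₁)
        (norm_fourierMul_le (mb2 t) (b2 t htc) φ₂))).trans ?_
      gcongr
    have hpos : ∀ x y : ℝ, 0 ≤ x → 0 ≤ y → x * ‖φ₁‖ + y * ‖φ₂‖ ≤ (x + y) * (‖φ₁‖ + ‖φ₂‖) :=
      fun x y hx hy => by nlinarith [mul_nonneg hx hφ₂, mul_nonneg hy hφ₁]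
    have f0 := hpos C₁ (C₂ * (1 + T)) hC₁.le (by positivity)
    have f1 := hpos (C₁ * (1 + T) ^ κ) (C₂ * (1 + T) ^ (1 + κ)) (by positivity) (by positivity)
    have f2 := hpos (C₃ * (1 + T) ^ κ) (C₄ * (1 + T) ^ κ) (by positivity) (by positivity)
    rw [add_mul, add_mul]
    linarith
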